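/- **Theorem (Inversion theorem for the two-sided quaternion Fourier transform, pointwise version).** Let $(x_0,y_0)\in\mathbb R^2$, let $\varepsilon_1,\varepsilon_2>0$, and let $f=f_0+\mathbf i f_1+\mathbf j f_2+\mathbf k f_3\in L^1(\mathbb R^2,\mathbb H)$ with real components $f_n$. Suppose that $f$ satisfies the following two conditions in the cross-neighbourhood $\{(s,t): |s-x_0|\le\varepsilon_1 \text{ or } |t-y_0|\le\varepsilon_2\}$ of $(x_0,y_0)$. 1. (QBVF) Each $f_n$ is of bounded variation on the central rectangle $R=[x_0-\varepsilon_1,x_0+\varepsilon_1]\times[y_0-\varepsilon_2,y_0+\varepsilon_2]$ of the cross (in particular this holds if the $f_n$ are of bounded variation on every closed rectangle contained in the cross). Here a real function $g$ is of bounded variation on $[a_1,b_1]\times[a_2,b_2]$ if the sums $\sum_{i<m}\sum_{j<n}|g(s_{i+1},t_{j+1})-g(s_{i+1},t_j)-g(s_i,t_{j+1})+g(s_i,t_j)|$ are bounded over all nets $a_1=s_0<\dots<s_m=b_1$, $a_2=t_0<\dots<t_n=b_2$, the function $g(\tilde s,\cdot)$ is of bounded variation on $[a_2,b_2]$ for at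 least one $\tilde s\in[a_1,b_1]$, and $g(\cdot,\tilde t)$ is of bounded variation on $[a_1,b_1]$ for at least one $\tilde t\in[a_2,b_2]$. 2. ($f\in\mathbf{LC}$) With $\tilde f(s,t)=f(x_0-s,y_0-t)+f(x_0+s,y_0+t)+f(x_0-s,y_0+t)+f(x_0+s,y_0-t)$, there are $a,b\in\mathbb R$ such that $\int_{\mathbb R}|\tilde f(a,t)|\,dt<\infty$, $\int_{\mathbb R}|\tilde f(s,b)|\,ds<\infty$, $$\int_{\varepsilon_2}^\infty\int_0^{\varepsilon_1}\left|\frac{\tilde f(s,t)-\tilde f(a,t)}{s}\right|ds\,dt<\infty,\qquad \int_{\varepsilon_1}^\infty\int_0^{\varepsilon_2}\left|\frac{\tilde f(s,t)-\tilde f(s,b)}{t}\right|dt\,ds<\infty.$$ Let $\mathcal F_T(u,v)=\int_{\mathbb R^2}e^{-\mathbf i us}f(s,t)e^{-\mathbf j vt}\,ds\,dt$ be the two-sided quaternion Fourier transform of $f$. Then the four double limits $f(x_0\pm0,y_0\pm0)$ exist, and $$\lim_{\substack{N\to\infty\\ M\to\infty}}\frac1{4\pi^2}\int_{-N}^{N}\int_{-M}^{M}e^{\mathbf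 i ux_0}\mathcal F_T(u,v)e^{\mathbf j vy_0}\,du\,dv=\eta(x_0,y_0)$$ ($N$ and $M$ tending to infinity independently), where $$\eta(x_0,y_0)=\frac{f(x_0+0,y_0+0)+f(x_0+0,y_0-0)+f(x_0-0,y_0+0)+f(x_0-0,y_0-0)}4=\eta_0+\mathbf i\eta_1+\mathbf j\eta_2+\mathbf k\eta_3,$$ and $\eta_n(x_0,y_0)$ is the corresponding four-corner average of $f_n$. If $f$ is continuous at $(x_0,y_0)$, then $\eta(x_0,y_0)=f(x_0,y_0)$. -/

import Mathlib

open MeasureTheory Filter Topology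

noncomputable section

namespace QFT

/-- The quaternion unit `i`. -/
def qi : Quaternion ℝ := ⟨0, 1, 0, 0⟩

/-- The quaternion unit `j`. -/
def qj : Quaternion ℝ := ⟨0, 0, 1, 0⟩

/-- The two-sided quaternion Fourier transform
`F_T(u,v) = ∫_{ℝ²} e^{-ius} f(s,t) e^{-jvt} ds dt`. -/
def twoSided (f : ℝ × ℝ → Quaternion ℝ) (u v : ℝ) : Quaternion ℝ :=
  ∫ p : ℝ × ℝ, NormedSpace.exp (-(u * p.1) • qi) * f p * NormedSpace.exp (-(v * p.2) • qj)

/-- The truncated inversion integral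
`(1/4π²) ∫_{-N}^{N} ∫_{-M}^{M} e^{iux} F_T(u,v) e^{jvy} du dv`. -/
def partialInverse (f : ℝ × ℝ → Quaternion ℝ) (x y N M : ℝ) : Quaternion ℝ :=
  (1 / (4 * Real.pi ^ 2)) • ∫ v in (-N)..N, ∫ u in (-M)..M,
    NormedSpace.exp ((u * x) • qi) * twoSided f u v * NormedSpace.exp ((v * y) • qj)

/-- A real function of two variables is of bounded variation (in the sense of Hardy) on the
rectangle `[a₁, b₁] × [a₂, b₂]`: the sums of `|Δ₁₁ g|` over the cells of all nets
`a₁ = s₀ < ⋯ < s_m = b₁`, `a₂ = t₀ < ⋯ < t_n = b₂` are bounded, and at least one section in each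
direction is of bounded variation in one variable. -/
structure IsBVF (g : ℝ × ℝ → ℝ) (a₁ b₁ a₂ b₂ : ℝ) : Prop where
  nets : ∃ C : ℝ, ∀ (m n : ℕ) (s t : ℕ → ℝ),
    StrictMonoOn s (Set.Iic m) → s 0 = a₁ → s m = b₁ →
    StrictMonoOn t (Set.Iic n) → t 0 = a₂ → t n = b₂ →
    ∑ i ∈ Finset.range m, ∑ j ∈ Finset.range n,
      |g (s (i + 1), t (j + 1)) - g (s (i + 1), t j) - g (s i, t (j + 1)) + g (s i, t j)| ≤ C
  section_snd : ∃ s ∈ Set.Icc a₁ b₁, BoundedVariationOn (fun t => g (s, t)) (Set.Icc a₂ b₂)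
  section_fst : ∃ t ∈ Set.Icc a₂ b₂, BoundedVariationOn (fun s => g (s, t)) (Set.Icc a₁ b₁)

/-- Quaternion bounded variation function: the four real components are of bounded variation. -/
structure IsQBVF (f : ℝ × ℝ → Quaternion ℝ) (a₁ b₁ a₂ b₂ : ℝ) : Prop where
  re : IsBVF (fun p => (f p).re) a₁ b₁ a₂ b₂
  imI : IsBVF (fun p => (f p).imI) a₁ b₁ a₂ b₂
  imJ : IsBVF (fun p => (f p).imJ) a₁ b₁ a₂ b₂
  imK : IsBVF (fun p => (f p).imK) a₁ b₁ a₂ b₂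

/-- The symmetrization `f̃(s,t)` of `f` about the point `(x, y)`. -/
def symm (f : ℝ × ℝ → Quaternion ℝ) (x y s t : ℝ) : Quaternion ℝ :=
  f (x - s, y - t) + f (x + s, y + t) + f (x - s, y + t) + f (x + s, y - t)

/-- The class `LC` in the cross-neighbourhood `{|s - x| ≤ ε₁ or |t - y| ≤ ε₂}` of `(x, y)`. The two
arms of the cross away from its central rectangle correspond to the domains of integration
`0 < s ≤ ε₁, ε₂ < t` and `ε₁ < s, 0 < t ≤ ε₂`. -/
structure IsLC (f : ℝ × ℝ → Quaternion ℝ) (x y ε₁ ε₂ : ℝ) : Prop where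
  fst : ∃ a : ℝ, Integrable (fun t => symm f x y a t) ∧
    IntegrableOn (fun p : ℝ × ℝ => p.1⁻¹ • (symm f x y p.1 p.2 - symm f x y a p.2))
      (Set.Ioc 0 ε₁ ×ˢ Set.Ioi ε₂)
  snd : ∃ b : ℝ, Integrable (fun s => symm f x y s b) ∧
    IntegrableOn (fun p : ℝ × ℝ => p.2⁻¹ • (symm f x y p.1 p.2 - symm f x y p.1 b))
      (Set.Ioi ε₁ ×ˢ Set.Ioc 0 ε₂)

section Corner

variable {E : Type*} [TopologicalSpace E]

/-- The four double limits `g(x ± 0, y ± 0)` exist. -/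
structure HasCornerLimits (g : ℝ × ℝ → E) (x y : ℝ) : Prop where
  pp : ∃ l, Tendsto g (𝓝[>] x ×ˢ 𝓝[>] y) (𝓝 l)
  pm : ∃ l, Tendsto g (𝓝[>] x ×ˢ 𝓝[<] y) (𝓝 l)
  mp : ∃ l, Tendsto g (𝓝[<] x ×ˢ 𝓝[>] y) (𝓝 l)
  mm : ∃ l, Tendsto g (𝓝[<] x ×ˢ 𝓝[<] y) (𝓝 l)

/-- The four-corner average
`(g(x+0,y+0) + g(x+0,y-0) + g(x-0,y+0) + g(x-0,y-0)) / 4`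
(meaningful when `HasCornerLimits g x y`). -/
def cornerAverage [AddCommGroup E] [Module ℝ E] (g : ℝ × ℝ → E) (x y : ℝ) : E :=
  (1 / 4 : ℝ) •
    (limUnder (𝓝[>] x ×ˢ 𝓝[>] y) g + limUnder (𝓝[>] x ×ˢ 𝓝[<] y) g +
      limUnder (𝓝[<] x ×ˢ 𝓝[>] y) g + limUnder (𝓝[<] x ×ˢ 𝓝[<] y) g)

end Corner

end QFT

end

/-!
Fubini's theorem turns the truncated inversion integral of the two-sided quaternion Fourier
transform into `∫ D_M(x - s) D_N(y - t) f(s, t)`, where `D_M(s) = sin (M s) / (π s)`. The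
exponentials in `i` stand on the left of `f` and those in `j` on the right, and over a symmetric
interval each of them integrates to a real number; the noncommutativity disappears, and it remains
to prove a statement about each real component of `f` (`partialInverse_eq`).

For a real function, reflection about `(x, y)` reduces the integral over the plane to the integral
of `f̃(s, t) D_M(s) D_N(t)` over the first quadrant, which is cut along `s = ε₁` and `t = ε₂`.

* Far from both axes `f̃(s, t) / (s t)` is integrable, and the Riemann–Lebesgue lemma in the plane
  gives the limit zero (`tendsto_setIntegral_far`).
* On the arm `s ≤ ε₁`, `t > ε₂` the function `f̃` is replaced by `f̃(a, t)`. The error over `s t` is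
  integrable by the class `LC`, so that Riemann–Lebesgue applies again; the integral of `f̃(a, t)`
  factors into a bounded integral in `s` and a one-dimensional Riemann–Lebesgue integral in `t`
  (`tendsto_setIntegral_arm`).
* On the central rectangle the claim is a Dirichlet–Jordan theorem at the corner of a rectangle,
  for functions of bounded variation in the sense of Hardy (`HardyOn.tendsto_integral_integral`).

The corner theorem is obtained by applying twice a one-dimensional Dirichlet–Jordan theorem that is
uniform in a parameter (`tendsto_integral_mul_dirichletKernel`). In the inner variable it gives the
limit of `H_N(s) = ∫ g(s, t) D_N(t) dt` for each fixed `s`; in the outer variable it is applied to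
the family `H_N` itself. The uniformity it requires is a bound for the variation of `H_N` on
`(0, δ]`, independent of `N` and tending to `0` with `δ`. Such a bound is
`K (Var g(·, b) + 4 Var₁₂ g)`, where `Var₁₂` is the variation on `(0, δ]` of the map `s ↦ g(s, ·)`
into the space of functions with the variation as distance, a variation that tends to `0` with `δ`
like that of every map of bounded variation. That `Var₁₂` is bounded by the sums over nets in the
definition of bounded variation is a matter of common refinements
(`eVariationOn_sectionMap_le`). The estimates rest on the value `π / 2` of the Dirichlet
integral and on a form of the second mean value theorem (`abs_integral_monotoneOn_mul_le`).
-/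

namespace QFT

open Set Real
open scoped ENNReal Quaternion

/-! ### The Dirichlet integral and the Dirichlet kernel -/

theorem integral_sin_mul_exp_neg (X y : ℝ) :
    ∫ x in (0 : ℝ)..X, sin x * exp (-(y * x)) =
      (1 + y ^ 2)⁻¹ - exp (-(X * y)) * ((y * sin X + cos X) / (1 + y ^ 2)) := by
  have hy : (1 + y ^ 2) ≠ 0 := by positivity
  have h : ∀ x ∈ uIcc 0 X, HasDerivAt
      (fun x => -(exp (-(y * x)) * ((y * sin x + cos x) / (1 + y ^ 2))))
      (sin x * exp (-(y * x))) x := by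
    intro x _
    have h1 : HasDerivAt (fun x : ℝ => exp (-(y * x))) (exp (-(y * x)) * (-(y * 1))) x :=
      (((hasDerivAt_id x).const_mul y).neg).exp
    have h2 : HasDerivAt (fun x : ℝ => (y * sin x + cos x) / (1 + y ^ 2))
        ((y * cos x + -sin x) / (1 + y ^ 2)) x :=
      (((hasDerivAt_sin x).const_mul y).add (hasDerivAt_cos x)).div_const _
    convert! (h1.mul h2).neg using 1
    field_simp
    ring
  rw [intervalIntegral.integral_eq_sub_of_hasDerivAt h]
  · simp [mul_comm y X]; ring
  · exact (by fun_prop : Continuous fun x : ℝ => sin x * exp (-(y * x))).intervalIntegrable _ _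

/-- Representing `1 / x` as a Laplace integral and exchanging the integrals evaluates the sine
integral up to an exponentially damped remainder. -/
theorem integral_sinc_eq {X : ℝ} (hX : 0 < X) :
    ∫ x in (0 : ℝ)..X, sinc x =
      π / 2 - ∫ y in Ioi (0 : ℝ), exp (-(X * y)) * ((y * sin X + cos X) / (1 + y ^ 2)) := by
  have hlap : ∀ x ∈ Ioc 0 X, IntegrableOn (fun y => exp (-(y * x))) (Ioi 0) ∧
      ∫ y in Ioi (0 : ℝ), exp (-(y * x)) = x⁻¹ := by
    intro x hx
    have e : (fun y => exp (-(y * x))) = fun y : ℝ => exp (-x * y) := by ext y; ring_nf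
    rw [e]
    refine ⟨integrableOn_exp_mul_Ioi (by linarith [hx.1]) 0, ?_⟩
    rw [integral_exp_mul_Ioi (by linarith [hx.1])]
    simp
  have hint : Integrable (fun p : ℝ × ℝ => sin p.1 * exp (-(p.2 * p.1)))
      ((volume.restrict (Ioc 0 X)).prod (volume.restrict (Ioi 0))) := by
    have hm : AEStronglyMeasurable (fun p : ℝ × ℝ => sin p.1 * exp (-(p.2 * p.1)))
        ((volume.restrict (Ioc 0 X)).prod (volume.restrict (Ioi 0))) :=
      (by fun_prop : Continuous fun p : ℝ × ℝ =>
        sin p.1 * exp (-(p.2 * p.1))).aestronglyMeasurable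
    rw [integrable_prod_iff hm]
    constructor
    · filter_upwards [ae_restrict_mem measurableSet_Ioc] with x hx
      exact (hlap x hx).1.const_mul _
    · have : IntegrableOn (fun x => |sinc x|) (Ioc 0 X) :=
        (continuous_sinc.abs.intervalIntegrable 0 X).1
      refine this.congr_fun (fun x hx => ?_) measurableSet_Ioc
      simp only [norm_mul, Real.norm_eq_abs, abs_exp]
      rw [integral_const_mul, (hlap x hx).2, sinc_of_ne_zero hx.1.ne', abs_div,
        abs_of_pos hx.1, div_eq_mul_inv]
  have hswap := integral_integral_swap (f := fun x y : ℝ => sin x * exp (-(y * x))) hint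
  have hA : ∫ x in Ioc 0 X, ∫ y in Ioi (0 : ℝ), sin x * exp (-(y * x)) =
      ∫ x in (0 : ℝ)..X, sinc x := by
    rw [intervalIntegral.integral_of_le hX.le]
    refine setIntegral_congr_fun measurableSet_Ioc fun x hx => ?_
    rw [integral_const_mul, (hlap x hx).2, sinc_of_ne_zero hx.1.ne', div_eq_mul_inv]
  have hB : ∀ y, ∫ x in Ioc 0 X, sin x * exp (-(y * x)) =
      (1 + y ^ 2)⁻¹ - exp (-(X * y)) * ((y * sin X + cos X) / (1 + y ^ 2)) := fun y => by
    rw [← intervalIntegral.integral_of_le hX.le, integral_sin_mul_exp_neg]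
  have hI := hint.integral_prod_right
  simp only at hswap hI
  rw [hA] at hswap
  simp_rw [hB] at hswap hI
  have h1 : IntegrableOn (fun y : ℝ => (1 + y ^ 2)⁻¹) (Ioi 0) :=
    integrable_inv_one_add_sq.integrableOn
  have h2 : IntegrableOn (fun y => exp (-(X * y)) * ((y * sin X + cos X) / (1 + y ^ 2)))
      (Ioi 0) := by
    refine (h1.sub hI).congr (Eventually.of_forall fun y => ?_)
    simp
  rw [hswap, integral_sub h1 h2, integral_Ioi_inv_one_add_sq]
  simp

/-- The Dirichlet integral `∫₀^∞ sin x / x dx = π / 2`, as an improper integral. -/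
theorem tendsto_integral_sinc :
    Tendsto (fun X : ℝ => ∫ x in (0 : ℝ)..X, sinc x) atTop (𝓝 (π / 2)) := by
  rw [tendsto_iff_norm_sub_tendsto_zero]
  have hlim : Tendsto (fun X : ℝ => 2 * X⁻¹) atTop (𝓝 0) := by
    simpa using tendsto_inv_atTop_zero.const_mul (2 : ℝ)
  refine squeeze_zero' (Eventually.of_forall fun _ => norm_nonneg _) ?_ hlim
  filter_upwards [eventually_gt_atTop 0] with X hX
  have hi : IntegrableOn (fun y : ℝ => exp (-X * y)) (Ioi 0) :=
    integrableOn_exp_mul_Ioi (by linarith) 0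
  have hv : ∫ y in Ioi (0 : ℝ), exp (-X * y) = X⁻¹ := by
    rw [integral_exp_mul_Ioi (by linarith)]; simp
  rw [integral_sinc_eq hX, sub_sub_cancel_left, norm_neg]
  calc _ ≤ ∫ y in Ioi (0 : ℝ), 2 * exp (-X * y) := by
        refine norm_integral_le_of_norm_le (hi.const_mul 2) ?_
        filter_upwards [ae_restrict_mem measurableSet_Ioi] with y hy
        have hy' : (0 : ℝ) < y := hy
        rw [norm_mul, Real.norm_eq_abs, abs_exp, mul_comm, neg_mul]
        gcongr
        rw [Real.norm_eq_abs, abs_div, abs_of_pos (by positivity : (0 : ℝ) < 1 + y ^ 2),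
          div_le_iff₀ (by positivity)]
        have := abs_sin_le_one X
        have := abs_cos_le_one X
        calc |y * sin X + cos X| ≤ |y * sin X| + |cos X| := abs_add_le _ _
          _ ≤ y * 1 + 1 := by rw [abs_mul, abs_of_pos hy']; gcongr
          _ ≤ 2 * (1 + y ^ 2) := by nlinarith [sq_nonneg (y - 1)]
    _ = 2 * X⁻¹ := by rw [integral_const_mul, hv]

/-- The Dirichlet kernel `sin (M s) / (π s)` of the real line, continuously extended to `s = 0`. -/
noncomputable def dirichletKernel (M s : ℝ) : ℝ := M / π * sinc (M * s)

@[fun_prop]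
theorem continuous_dirichletKernel (M : ℝ) : Continuous (dirichletKernel M) :=
  continuous_const.mul (continuous_sinc.comp (continuous_const.mul continuous_id))

theorem dirichletKernel_neg (M s : ℝ) : dirichletKernel M (-s) = dirichletKernel M s := by
  simp [dirichletKernel]

theorem dirichletKernel_of_ne_zero (M : ℝ) {s : ℝ} (hs : s ≠ 0) :
    dirichletKernel M s = π⁻¹ * (sin (M * s) * s⁻¹) := by
  rcases eq_or_ne M 0 with rfl | hM
  · simp [dirichletKernel]
  · rw [dirichletKernel, sinc_of_ne_zero (mul_ne_zero hM hs)]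
    field_simp

theorem abs_dirichletKernel_le (M s : ℝ) : |dirichletKernel M s| ≤ |M| / π := by
  rw [dirichletKernel, abs_mul, abs_div, abs_of_pos pi_pos]
  exact mul_le_of_le_one_right (by positivity) (abs_sinc_le_one _)

theorem integral_dirichletKernel (M x y : ℝ) :
    ∫ s in x..y, dirichletKernel M s =
      π⁻¹ * ((∫ r in (0 : ℝ)..(M * y), sinc r) - ∫ r in (0 : ℝ)..(M * x), sinc r) := by
  have hi : ∀ a b : ℝ, IntervalIntegrable sinc volume a b := fun a b =>
    continuous_sinc.intervalIntegrable a b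
  simp only [dirichletKernel, intervalIntegral.integral_const_mul]
  rw [intervalIntegral.integral_interval_sub_left (hi _ _) (hi _ _),
    ← intervalIntegral.mul_integral_comp_mul_left]
  ring

/-- The Dirichlet kernels have uniformly bounded integrals over the intervals of `[0, ∞)`. -/
theorem exists_bound_integral_dirichletKernel :
    ∃ K : ℝ, 0 < K ∧ ∀ M x y : ℝ, 0 ≤ M → 0 ≤ x → 0 ≤ y →
      |∫ s in x..y, dirichletKernel M s| ≤ K := by
  obtain ⟨K, hK⟩ : ∃ K : ℝ, ∀ X : ℝ, 0 ≤ X → |∫ r in (0 : ℝ)..X, sinc r| ≤ K := by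
    have hc : Continuous fun X : ℝ => ∫ r in (0 : ℝ)..X, sinc r :=
      intervalIntegral.continuous_primitive (fun a b => continuous_sinc.intervalIntegrable a b) 0
    obtain ⟨B, hB⟩ := eventually_atTop.1
      (tendsto_integral_sinc.abs.eventually_le_const (lt_add_one _))
    obtain ⟨C, hC⟩ := isCompact_Icc.exists_bound_of_continuousOn (s := Icc 0 B) hc.continuousOn
    refine ⟨max C (|π / 2| + 1), fun X hX => ?_⟩
    rcases le_total B X with h | h
    · exact (hB X h).trans (le_max_right _ _)
    · exact (hC X ⟨hX, h⟩).trans (le_max_left _ _)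
  have hK0 : 0 ≤ K := (abs_nonneg _).trans (hK 0 le_rfl)
  refine ⟨π⁻¹ * (K + K) + 1, by positivity, fun M x y hM hx hy => ?_⟩
  rw [integral_dirichletKernel, abs_mul, abs_of_pos (inv_pos.2 pi_pos)]
  have := (abs_sub _ _).trans (add_le_add (hK (M * y) (by positivity)) (hK (M * x) (by positivity)))
  have : π⁻¹ * |(∫ r in (0 : ℝ)..(M * y), sinc r) - ∫ r in (0 : ℝ)..(M * x), sinc r| ≤
    π⁻¹ * (K + K) := by gcongr
  linarith

theorem tendsto_integral_dirichletKernel {δ : ℝ} (hδ : 0 < δ) :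
    Tendsto (fun M => ∫ s in (0 : ℝ)..δ, dirichletKernel M s) atTop (𝓝 (1 / 2)) := by
  simp_rw [integral_dirichletKernel]
  have := (tendsto_integral_sinc.comp (tendsto_id.atTop_mul_const hδ)).const_mul π⁻¹
  have e : π⁻¹ * (π / 2) = 1 / 2 := by field_simp
  rw [e] at this
  simpa using this

/-- Away from the origin the integrals of the Dirichlet kernels are uniformly small. -/
theorem eventually_integral_dirichletKernel_le {δ ε : ℝ} (hδ : 0 < δ) (hε : 0 < ε) :
    ∀ᶠ M in atTop, ∀ x y : ℝ, δ ≤ x → δ ≤ y → |∫ s in x..y, dirichletKernel M s| ≤ ε := by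
  have h := Metric.tendsto_atTop.1 tendsto_integral_sinc (ε * π / 2) (by positivity)
  obtain ⟨B, hB⟩ := h
  filter_upwards [eventually_ge_atTop (max 0 (B / δ))] with M hM x y hx hy
  have hM0 : 0 ≤ M := (le_max_left _ _).trans hM
  have hMB : B ≤ M * δ := (div_le_iff₀ hδ).1 ((le_max_right _ _).trans hM)
  have h1 := hB (M * x) (hMB.trans (by gcongr))
  have h2 := hB (M * y) (hMB.trans (by gcongr))
  rw [integral_dirichletKernel, abs_mul, abs_of_pos (inv_pos.2 pi_pos)]
  rw [inv_mul_le_iff₀ pi_pos, ← Real.dist_eq]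
  have := dist_triangle_right (∫ r in (0 : ℝ)..(M * y), sinc r)
    (∫ r in (0 : ℝ)..(M * x), sinc r) (π / 2)
  linarith

/-! ### Functions of bounded variation against oscillating kernels -/

theorem integrableOn_of_monotoneOn_of_abs_le {p : ℝ → ℝ} {c d B : ℝ}
    (hp : MonotoneOn p (Ioc c d)) (hB : ∀ x ∈ Ioc c d, |p x| ≤ B) : IntegrableOn p (Ioc c d) :=
  Integrable.of_bound
    (aemeasurable_restrict_of_monotoneOn measurableSet_Ioc hp).aestronglyMeasurable B
    (by filter_upwards [ae_restrict_mem measurableSet_Ioc] with x hx using hB x hx)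

/-- The superlevel sets of a monotone function on `(c, d]` are intervals ending at `d`. -/
theorem exists_superlevel_ae_eq_Ioc {p : ℝ → ℝ} {c d : ℝ} (hcd : c ≤ d)
    (hp : MonotoneOn p (Ioc c d)) (r : ℝ) :
    ∃ e ∈ Icc c d, {x | x ∈ Ioc c d ∧ r < p x} =ᵐ[volume] Ioc e d := by
  set U := {x | x ∈ Ioc c d ∧ r < p x} with hU
  rcases U.eq_empty_or_nonempty with h | h
  · exact ⟨d, ⟨hcd, le_rfl⟩, by simp [h]⟩
  have hbdd : BddBelow U := ⟨c, fun x hx => hx.1.1.le⟩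
  refine ⟨sInf U, ⟨le_csInf h fun x hx => hx.1.1.le, ?_⟩, ?_⟩
  · obtain ⟨x, hx⟩ := h
    exact (csInf_le hbdd hx).trans hx.1.2
  · have h1 : Ioc (sInf U) d ⊆ U := by
      intro x hx
      obtain ⟨y, hy, hyx⟩ := (csInf_lt_iff hbdd h).1 hx.1
      have hxI : x ∈ Ioc c d := ⟨hy.1.1.trans hyx, hx.2⟩
      exact ⟨hxI, hy.2.trans_le (hp hy.1 hxI hyx.le)⟩
    have h2 : U ⊆ Icc (sInf U) d := fun x hx => ⟨csInf_le hbdd hx, hx.1.2⟩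
    have h3 := (Ioc_ae_eq_Icc (μ := (volume : Measure ℝ)) (a := sInf U) (b := d)).symm.le
    exact (LE.le.eventuallyLE h2 |>.trans h3).antisymm
      (LE.le.eventuallyLE h1)

/-- A form of the second mean value theorem: by the layer-cake formula, the integral of `p * ψ` is
an average of integrals of `ψ` over the superlevel sets of `p`, which are intervals. -/
theorem abs_integral_monotoneOn_mul_le {p ψ : ℝ → ℝ} {c d B K : ℝ} (hcd : c ≤ d)
    (hp : MonotoneOn p (Ioc c d)) (hp0 : ∀ x ∈ Ioc c d, 0 ≤ p x) (hpB : ∀ x ∈ Ioc c d, p x ≤ B)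
    (hB : 0 ≤ B) (hψ : Continuous ψ) (hK : ∀ e ∈ Icc c d, |∫ x in e..d, ψ x| ≤ K) :
    |∫ x in c..d, p x * ψ x| ≤ B * K := by
  set μ := volume.restrict (Ioc c d)
  set ν := volume.restrict (Ioc 0 B)
  have hpm : AEMeasurable p μ := aemeasurable_restrict_of_monotoneOn measurableSet_Ioc hp
  have hψi : Integrable ψ μ := (hψ.intervalIntegrable c d).1
  -- `p x` is the length of the set of `r ∈ (0, B]` with `r < p x`.
  let F : ℝ × ℝ → ℝ := {q : ℝ × ℝ | q.2 < p q.1}.indicator fun q => ψ q.1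
  have hF : Integrable F (μ.prod ν) :=
    (hψi.comp_fst ν).indicator₀ (nullMeasurableSet_lt measurable_snd.aemeasurable hpm.comp_fst)
  have hin : ∀ x ∈ Ioc c d, ∫ r, F (x, r) ∂ν = p x * ψ x := by
    intro x hx
    have e : (fun r => F (x, r)) = (Iio (p x)).indicator fun _ => ψ x := by
      ext r; simp [F, indicator]
    have e2 : (Iio (p x) ∩ Ioc 0 B : Set ℝ) =ᵐ[volume] (Ioc 0 (p x) : Set ℝ) := by
      have : Iio (p x) ∩ Ioc 0 B = Ioo 0 (p x) := by
        ext r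
        simp only [mem_inter_iff, mem_Iio, mem_Ioc, mem_Ioo]
        exact ⟨fun h => ⟨h.2.1, h.1⟩, fun h => ⟨h.2, h.1, h.2.le.trans (hpB x hx)⟩⟩
      rw [this]
      exact Ioo_ae_eq_Ioc
    rw [e, integral_indicator_const _ measurableSet_Iio, measureReal_def,
      Measure.restrict_apply measurableSet_Iio, measure_congr e2, Real.volume_Ioc, sub_zero,
      ENNReal.toReal_ofReal (hp0 x hx), smul_eq_mul]
  have hout : ∀ r, |∫ x, F (x, r) ∂μ| ≤ K := by
    intro r
    obtain ⟨e, he, hae⟩ := exists_superlevel_ae_eq_Ioc hcd hp r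
    have : ∫ x, F (x, r) ∂μ = ∫ x in e..d, ψ x := by
      rw [intervalIntegral.integral_of_le he.2, ← setIntegral_congr_set hae]
      have h1 : (fun x => F (x, r)) = {x | r < p x}.indicator ψ := by
        ext x; simp [F, indicator]
      rw [h1, integral_indicator₀ (nullMeasurableSet_lt aemeasurable_const hpm),
        Measure.restrict_restrict₀ (nullMeasurableSet_lt aemeasurable_const hpm)]
      congr 2
      ext x
      simp [and_comm]
    rw [this]
    exact hK e he
  have hsw := integral_integral_swap (f := fun x r => F (x, r)) hF
  rw [intervalIntegral.integral_of_le hcd,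
    ← setIntegral_congr_fun measurableSet_Ioc hin, hsw]
  have hfin := norm_integral_le_of_norm_le_const (μ := ν)
    (f := fun r => ∫ x, F (x, r) ∂μ) (Eventually.of_forall hout)
  rw [mul_comm]
  simpa [ν, measureReal_def, ENNReal.toReal_ofReal hB] using hfin

section BoundedVariation

variable {H ψ : ℝ → ℝ} {c d K : ℝ}

theorem _root_.BoundedVariationOn.intervalIntegrable_of_Ioc (hcd : c ≤ d)
    (hH : BoundedVariationOn H (Ioc c d)) : IntervalIntegrable H volume c d := by
  rcases hcd.eq_or_lt with rfl | hcd
  · simp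
  have hd : d ∈ Ioc c d := ⟨hcd, le_rfl⟩
  rw [intervalIntegrable_iff_integrableOn_Ioc_of_le hcd.le]
  have hP := variationOnFromTo.monotoneOn hH.locallyBoundedVariationOn hd
  have hQ := variationOnFromTo.sub_self_monotoneOn hH.locallyBoundedVariationOn hd
  have hPV : ∀ x ∈ Ioc c d, |variationOnFromTo H (Ioc c d) d x| ≤
    (eVariationOn H (Ioc c d)).toReal := fun x _ => variationOnFromTo.abs_le_eVariationOn hH
  have h1 := integrableOn_of_monotoneOn_of_abs_le hP hPV
  have h2 := integrableOn_of_monotoneOn_of_abs_le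
    (B := (eVariationOn H (Ioc c d)).toReal + ((eVariationOn H (Ioc c d)).toReal + |H d|)) hQ
    fun x hx => (abs_sub _ _).trans (add_le_add (hPV x hx) (by
      have := hH.dist_le hx hd
      rw [Real.dist_eq] at this
      have := abs_sub_abs_le_abs_sub (H x) (H d)
      linarith))
  refine (h1.sub h2).congr (Eventually.of_forall fun x => ?_)
  simp

/-- Integrating a function of bounded variation against a function with small primitives gives
something small, as soon as the function is normalized to vanish at the right endpoint. -/
theorem abs_integral_sub_mul_le (hcd : c < d) (hH : BoundedVariationOn H (Ioc c d))
    (hψ : Continuous ψ) (hK : ∀ e ∈ Icc c d, |∫ x in e..d, ψ x| ≤ K) :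
    |∫ x in c..d, (H x - H d) * ψ x| ≤ 4 * K * (eVariationOn H (Ioc c d)).toReal := by
  set V := (eVariationOn H (Ioc c d)).toReal
  have hV : 0 ≤ V := ENNReal.toReal_nonneg
  have hd : d ∈ Ioc c d := ⟨hcd, le_rfl⟩
  have hP := variationOnFromTo.monotoneOn hH.locallyBoundedVariationOn hd
  have hQ := variationOnFromTo.sub_self_monotoneOn hH.locallyBoundedVariationOn hd
  set P := variationOnFromTo H (Ioc c d) d with hPdef
  have hPV : ∀ x ∈ Ioc c d, -V ≤ P x := fun x _ =>
    (abs_le.1 (variationOnFromTo.abs_le_eVariationOn hH)).1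
  have hP0 : ∀ x ∈ Ioc c d, P x ≤ 0 := fun x hx => variationOnFromTo.nonpos_of_ge H _ hx.2
  have hHV : ∀ x ∈ Ioc c d, |H x - H d| ≤ V := fun x hx => hH.dist_le hx hd
  have hPd : P d = 0 := variationOnFromTo.self H _ d
  -- `H - H d = (P + V) - (P - H + H d + 2 V) + V` with monotone nonnegative `P + V` and
  -- `P - H + H d + 2 V`, where `P` is the signed variation of `H` based at `d`.
  have e : ∀ x, (H x - H d) * ψ x =
      (P x + V) * ψ x - (P x - H x + (H d + 2 * V)) * ψ x + V * ψ x := fun x => by ring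
  have m1 : MonotoneOn (fun x => P x + V) (Ioc c d) := fun x hx y hy hxy => by
    simpa using hP hx hy hxy
  have m2 : MonotoneOn (fun x => P x - H x + (H d + 2 * V)) (Ioc c d) := fun x hx y hy hxy => by
    simpa using hQ hx hy hxy
  have m20 : ∀ x ∈ Ioc c d, 0 ≤ P x - H x + (H d + 2 * V) := fun x hx => by
    have := abs_le.1 (hHV x hx); have := hPV x hx; linarith
  have m2B : ∀ x ∈ Ioc c d, P x - H x + (H d + 2 * V) ≤ 2 * V := fun x hx => by
    have := hQ hx hd hx.2
    simp only [Pi.sub_apply, hPd] at this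
    linarith
  have b1 := abs_integral_monotoneOn_mul_le (B := V) hcd.le m1
    (fun x hx => by have := hPV x hx; linarith) (fun x hx => by have := hP0 x hx; linarith)
    hV hψ hK
  have b2 := abs_integral_monotoneOn_mul_le (B := 2 * V) hcd.le m2 m20 m2B (by positivity) hψ hK
  have b3 : |∫ x in c..d, V * ψ x| ≤ V * K := by
    rw [intervalIntegral.integral_const_mul, abs_mul, abs_of_nonneg hV]
    exact mul_le_mul_of_nonneg_left (hK c ⟨le_rfl, hcd.le⟩) hV
  have i1 : IntervalIntegrable (fun x => (P x + V) * ψ x) volume c d := by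
    refine IntervalIntegrable.mul_continuousOn ?_ hψ.continuousOn
    rw [intervalIntegrable_iff_integrableOn_Ioc_of_le hcd.le]
    exact integrableOn_of_monotoneOn_of_abs_le (B := V) m1 fun x hx =>
      abs_le.2 ⟨by have := hPV x hx; linarith, by have := hP0 x hx; linarith⟩
  have i2 : IntervalIntegrable (fun x => (P x - H x + (H d + 2 * V)) * ψ x) volume c d := by
    refine IntervalIntegrable.mul_continuousOn ?_ hψ.continuousOn
    rw [intervalIntegrable_iff_integrableOn_Ioc_of_le hcd.le]
    exact integrableOn_of_monotoneOn_of_abs_le (B := 2 * V) m2 fun x hx =>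
      abs_le.2 ⟨by have := m20 x hx; linarith, m2B x hx⟩
  have i3 : IntervalIntegrable (fun x => V * ψ x) volume c d :=
    (hψ.intervalIntegrable c d).const_mul V
  simp_rw [e]
  rw [intervalIntegral.integral_add (i1.sub i2) i3, intervalIntegral.integral_sub i1 i2]
  have t1 := abs_add_le ((∫ x in c..d, (P x + V) * ψ x) -
    ∫ x in c..d, (P x - H x + (H d + 2 * V)) * ψ x) (∫ x in c..d, V * ψ x)
  have t2 := abs_sub (∫ x in c..d, (P x + V) * ψ x)
    (∫ x in c..d, (P x - H x + (H d + 2 * V)) * ψ x)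
  linarith

theorem integral_mul_eq_integral_sub_mul_add (hcd : c ≤ d) (hH : BoundedVariationOn H (Ioc c d))
    (hψ : Continuous ψ) :
    ∫ x in c..d, H x * ψ x = (∫ x in c..d, (H x - H d) * ψ x) + H d * ∫ x in c..d, ψ x := by
  have i := (hH.intervalIntegrable_of_Ioc hcd)
  rw [← intervalIntegral.integral_const_mul, ← intervalIntegral.integral_add
    ((i.sub intervalIntegrable_const).mul_continuousOn hψ.continuousOn)
    ((hψ.intervalIntegrable c d).const_mul _)]
  congr 1
  ext x
  ring

theorem abs_integral_mul_le (hcd : c < d) (hH : BoundedVariationOn H (Ioc c d))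
    (hψ : Continuous ψ) (hK : ∀ e ∈ Icc c d, |∫ x in e..d, ψ x| ≤ K) :
    |∫ x in c..d, H x * ψ x| ≤ K * (|H d| + 4 * (eVariationOn H (Ioc c d)).toReal) := by
  rw [integral_mul_eq_integral_sub_mul_add hcd.le hH hψ]
  have h1 := abs_integral_sub_mul_le hcd hH hψ hK
  have h2 := mul_le_mul_of_nonneg_left (hK c ⟨le_rfl, hcd.le⟩) (abs_nonneg (H d))
  rw [← abs_mul] at h2
  have := abs_add_le (∫ x in c..d, (H x - H d) * ψ x) (H d * ∫ x in c..d, ψ x)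
  linarith

end BoundedVariation

/-- The Dirichlet–Jordan theorem at the left endpoint of `(0, a]`, uniformly in a parameter: the
functions `H i` need only be of uniformly bounded variation, with variation near `0` that is
uniformly small, and with values near `0` that are eventually close to `l`. -/
theorem tendsto_integral_mul_dirichletKernel {ι : Type*} {F : Filter ι} {H : ι → ℝ → ℝ}
    {a l C : ℝ} (hbv : ∀ i, eVariationOn (H i) (Ioc 0 a) ≤ ENNReal.ofReal C)
    (hC : ∀ i, |H i a| ≤ C)
    (hsmall : ∀ ε > 0, ∃ δ ∈ Ioc 0 a,
      (∀ i, eVariationOn (H i) (Ioc 0 δ) ≤ ENNReal.ofReal ε) ∧ ∀ᶠ i in F, |H i δ - l| ≤ ε) :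
    Tendsto (fun q : ι × ℝ => ∫ s in (0 : ℝ)..a, H q.1 s * dirichletKernel q.2 s)
      (F ×ˢ atTop) (𝓝 (l / 2)) := by
  rcases isEmpty_or_nonempty ι with hι | ⟨⟨i₀⟩⟩
  · simp [Filter.filter_eq_bot_of_isEmpty F]
  have hC0 : 0 ≤ C := (abs_nonneg _).trans (hC i₀)
  obtain ⟨K, hK0, hK⟩ := exists_bound_integral_dirichletKernel
  rw [Metric.tendsto_nhds]
  intro η hη
  -- The constant `5 K + 2` collects: `4 K ε` from the oscillation of `H i` on `(0, δ]`, `K ε` from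
  -- replacing `H i δ` by `l`, and `ε` each from the limit `1 / 2` and from the interval `(δ, a]`.
  obtain ⟨ε, hε, hεη⟩ : ∃ ε > 0, (5 * K + 2) * ε < η := by
    refine ⟨η / (5 * K + 3), by positivity, ?_⟩
    rw [← mul_div_assoc, div_lt_iff₀ (by positivity)]
    nlinarith
  obtain ⟨δ, hδ, hvar, hlim⟩ := hsmall ε hε
  have e1 : ∀ᶠ M : ℝ in atTop, 0 ≤ M := eventually_ge_atTop 0
  have e2 : ∀ᶠ M in atTop, |l * ((∫ s in (0 : ℝ)..δ, dirichletKernel M s) - 1 / 2)| < ε := by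
    have h := ((tendsto_integral_dirichletKernel hδ.1).sub_const (1 / 2)).const_mul l
    simp only [sub_self, mul_zero] at h
    have := h.abs.eventually_lt_const (u := ε) (by simpa using hε)
    exact this
  have e3 := eventually_integral_dirichletKernel_le hδ.1
    (show 0 < ε / (5 * C + 1) by positivity)
  filter_upwards [hlim.prod_mk (e1.and (e2.and e3))] with q hq
  obtain ⟨h1, hM, h2, h3⟩ := hq
  set i := q.1
  set M := q.2
  have hfin : BoundedVariationOn (H i) (Ioc 0 a) :=
    ne_top_of_le_ne_top ENNReal.ofReal_ne_top (hbv i)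
  have hfin1 : BoundedVariationOn (H i) (Ioc 0 δ) := hfin.mono (Ioc_subset_Ioc_right hδ.2)
  have hfin2 : BoundedVariationOn (H i) (Ioc δ a) := hfin.mono (Ioc_subset_Ioc_left hδ.1.le)
  have hψ := continuous_dirichletKernel M
  have hv1 : (eVariationOn (H i) (Ioc 0 δ)).toReal ≤ ε :=
    ENNReal.toReal_le_of_le_ofReal hε.le (hvar i)
  have hv2 : (eVariationOn (H i) (Ioc δ a)).toReal ≤ C :=
    ENNReal.toReal_le_of_le_ofReal hC0
      ((eVariationOn.mono _ (Ioc_subset_Ioc_left hδ.1.le)).trans (hbv i))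
  have b1 : |∫ s in (0 : ℝ)..δ, (H i s - H i δ) * dirichletKernel M s| ≤ 4 * K * ε :=
    (abs_integral_sub_mul_le hδ.1 hfin1 hψ fun e he => hK M e δ hM he.1 hδ.1.le).trans
      (by gcongr)
  have b2 : |∫ s in δ..a, H i s * dirichletKernel M s| ≤ ε := by
    rcases hδ.2.eq_or_lt with h | h
    · simp [h, hε.le]
    · refine (abs_integral_mul_le h hfin2 hψ fun e he => h3 e a he.1 hδ.2).trans ?_
      rw [div_mul_eq_mul_div, div_le_iff₀ (by positivity)]
      have := hC i
      exact mul_le_mul_of_nonneg_left (by linarith) hε.le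
  have b3 : |(H i δ - l) * ∫ s in (0 : ℝ)..δ, dirichletKernel M s| ≤ ε * K := by
    rw [abs_mul]
    exact mul_le_mul h1 (hK M 0 δ hM le_rfl hδ.1.le) (abs_nonneg _) hε.le
  have hsplit : ∫ s in (0 : ℝ)..a, H i s * dirichletKernel M s =
      (∫ s in (0 : ℝ)..δ, (H i s - H i δ) * dirichletKernel M s) +
        H i δ * (∫ s in (0 : ℝ)..δ, dirichletKernel M s) +
        ∫ s in δ..a, H i s * dirichletKernel M s := by
    rw [← integral_mul_eq_integral_sub_mul_add hδ.1.le hfin1 hψ,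
      intervalIntegral.integral_add_adjacent_intervals]
    · exact (hfin1.intervalIntegrable_of_Ioc hδ.1.le).mul_continuousOn hψ.continuousOn
    · exact (hfin2.intervalIntegrable_of_Ioc hδ.2).mul_continuousOn hψ.continuousOn
  rw [Real.dist_eq, hsplit]
  have b1' := abs_le.1 b1
  have b2' := abs_le.1 b2
  have b3' := abs_le.1 b3
  have b4' := abs_lt.1 h2
  refine lt_of_le_of_lt (abs_le.2 ⟨?_, ?_⟩) hεη <;> nlinarith

/-! ### Bounded variation in the sense of Hardy -/

theorem eVariationOn_add_le (f g : ℝ → ℝ) (T : Set ℝ) :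
    eVariationOn (f + g) T ≤ eVariationOn f T + eVariationOn g T := by
  refine iSup_le fun ⟨n, u, hu, hT⟩ => ?_
  calc ∑ i ∈ Finset.range n, edist ((f + g) (u (i + 1))) ((f + g) (u i))
      ≤ ∑ i ∈ Finset.range n,
          (edist (f (u (i + 1))) (f (u i)) + edist (g (u (i + 1))) (g (u i))) :=
        Finset.sum_le_sum fun i _ => edist_add_add_le _ _ _ _
    _ ≤ _ := by
        rw [Finset.sum_add_distrib]
        exact add_le_add (eVariationOn.sum_le hu hT) (eVariationOn.sum_le hu hT)

theorem eVariationOn_neg (f : ℝ → ℝ) (T : Set ℝ) : eVariationOn (-f) T = eVariationOn f T := by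
  simp [eVariationOn, edist_neg_neg]

/-- Real functions on the line, with the variation on `T` of the difference as distance. The joint
variation of a function `g` of two variables on `S × T` is the variation on `S` of the map
`s ↦ g (s, ·)` into this space. -/
def VarSpace (_T : Set ℝ) : Type := ℝ → ℝ

noncomputable instance (T : Set ℝ) : PseudoEMetricSpace (VarSpace T) where
  edist f g := eVariationOn (fun t => (f : ℝ → ℝ) t - (g : ℝ → ℝ) t) T
  edist_self f := eVariationOn.constant_on (by
    rintro _ ⟨x, _, rfl⟩ _ ⟨y, _, rfl⟩
    simp)
  edist_comm f g := by
    rw [← eVariationOn_neg]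
    congr 1
    ext t
    simp
  edist_triangle f g h := by
    refine le_trans (le_of_eq ?_) (eVariationOn_add_le _ _ _)
    congr 1
    ext t
    simp

/-- The section `g (s, ·)` of `g`, as a point of `VarSpace T`. -/
def sectionMap (g : ℝ × ℝ → ℝ) (T : Set ℝ) (s : ℝ) : VarSpace T := fun t => g (s, t)

theorem edist_sectionMap (g : ℝ × ℝ → ℝ) (T : Set ℝ) (s s' : ℝ) :
    edist (sectionMap g T s) (sectionMap g T s') =
      eVariationOn (fun t => g (s, t) - g (s', t)) T := rfl

theorem edist_sub_sub_le_edist_sectionMap (g : ℝ × ℝ → ℝ) {T : Set ℝ} {t t' : ℝ} (ht : t ∈ T)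
    (ht' : t' ∈ T) (s s' : ℝ) :
    edist (g (s, t) - g (s, t')) (g (s', t) - g (s', t')) ≤
      edist (sectionMap g T s) (sectionMap g T s') := by
  rw [edist_sectionMap]
  refine le_trans (le_of_eq ?_) (eVariationOn.edist_le _ ht ht')
  simp only [edist_dist, Real.dist_eq]
  congr 2
  ring

/-- A function of two variables of bounded variation on `S × T` in the sense of Hardy, expressed
through the total variations of its sections and of the family of its sections. -/
structure HardyOn (g : ℝ × ℝ → ℝ) (S T : Set ℝ) : Prop where
  joint : BoundedVariationOn (sectionMap g T) S
  snd : ∀ s ∈ S, BoundedVariationOn (fun t => g (s, t)) T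
  fst : ∀ t ∈ T, BoundedVariationOn (fun s => g (s, t)) S

/-- A finite subset of `[a, b]` containing both endpoints is enumerated by a net, extended
constantly beyond its last point so as to be monotone on all of `ℕ`. -/
theorem exists_net_of_finset {T : Finset ℝ} {a b : ℝ} (ha : a ∈ T) (hb : b ∈ T)
    (hT : ∀ x ∈ T, x ∈ Icc a b) :
    ∃ (m : ℕ) (u : ℕ → ℝ), Monotone u ∧ StrictMonoOn u (Iic m) ∧ u 0 = a ∧ u m = b ∧
      u '' Iic m = T := by
  have hpos : 0 < T.card := Finset.card_pos.2 ⟨a, ha⟩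
  let u : ℕ → ℝ := fun n ↦ T.orderEmbOfFin rfl ⟨min n (T.card - 1), by grind⟩
  have hmono : Monotone u := fun _ _ _ ↦ OrderEmbedding.monotone _ (by grind)
  have himg : u '' Iic (T.card - 1) = T := by
    ext x
    simp only [← T.range_orderEmbOfFin rfl, mem_image, mem_Iic, mem_range, u]
    constructor
    · rintro ⟨i, -, rfl⟩; exact ⟨_, rfl⟩
    · rintro ⟨i, rfl⟩; exact ⟨i, by omega, by congr; omega⟩
  have hmem : ∀ n, u n ∈ T := fun n => Finset.orderEmbOfFin_mem _ _ _
  refine ⟨T.card - 1, u, hmono, fun i hi j hj hij => ?_, ?_, ?_, himg⟩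
  · refine (T.orderEmbOfFin rfl).strictMono ?_
    simp only [mem_Iic] at hi hj
    simp only [Fin.mk_lt_mk]
    omega
  · obtain ⟨i, -, hi⟩ := himg.ge (Finset.mem_coe.2 ha)
    exact le_antisymm (hi ▸ hmono (Nat.zero_le i)) (hT _ (hmem _)).1
  · obtain ⟨i, hi', hi⟩ := himg.ge (Finset.mem_coe.2 hb)
    exact le_antisymm (hT _ (hmem _)).2 (hi ▸ hmono hi')

section Nets

variable {E : Type*} [PseudoEMetricSpace E]

open scoped Classical in
/-- A finite set, cut down to `[a, b]` and enlarged by the endpoints. -/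
noncomputable def netOf (a b : ℝ) (T : Finset ℝ) : Finset ℝ :=
  insert a (insert b (T.filter fun x => x ∈ Icc a b))

theorem netOf_mono (a b : ℝ) : Monotone (netOf a b) := fun T U h => by
  classical
  unfold netOf
  gcongr

theorem coe_netOf_subset {a b : ℝ} (hab : a ≤ b) (T : Finset ℝ) :
    (netOf a b T : Set ℝ) ⊆ Icc a b := by
  intro x hx
  simp only [netOf, Finset.coe_insert, mem_insert_iff, Finset.mem_coe, Finset.mem_filter] at hx
  rcases hx with rfl | rfl | hx
  · exact ⟨le_rfl, hab⟩
  · exact ⟨hab, le_rfl⟩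
  · exact hx.2

theorem eVariationOn_Icc_eq_iSup {a b : ℝ} (hab : a ≤ b) (F : ℝ → E) :
    eVariationOn F (Icc a b) = ⨆ T : Finset ℝ, eVariationOn F (netOf a b T) := by
  classical
  refine le_antisymm (iSup_le fun ⟨n, u, hu, hmem⟩ => ?_)
    (iSup_le fun T => eVariationOn.mono _ (coe_netOf_subset hab T))
  refine le_iSup_of_le ((Finset.range (n + 1)).image u) ?_
  refine eVariationOn.sum_le_of_monotoneOn_Iic (hu.monotoneOn _) fun i hi => ?_
  simp only [netOf, Finset.coe_insert, mem_insert_iff, Finset.mem_coe, Finset.mem_filter,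
    Finset.mem_image, Finset.mem_range]
  exact Or.inr (Or.inr ⟨⟨i, by omega, rfl⟩, hmem i⟩)

theorem exists_net_netOf {a b : ℝ} (hab : a ≤ b) (T : Finset ℝ) :
    ∃ (m : ℕ) (u : ℕ → ℝ), Monotone u ∧ StrictMonoOn u (Iic m) ∧ u 0 = a ∧ u m = b ∧
      u '' Iic m = netOf a b T :=
  exists_net_of_finset (by simp [netOf]) (by simp [netOf])
    fun _ hx => coe_netOf_subset hab T (Finset.mem_coe.2 hx)

end Nets

/-- The joint variation is the supremum of the sums over nets: a finite number of sections can be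
tested on a common refinement of their nets. -/
theorem eVariationOn_sectionMap_le {g : ℝ × ℝ → ℝ} {a₁ b₁ a₂ b₂ C : ℝ}
    (h₁ : a₁ ≤ b₁) (h₂ : a₂ ≤ b₂)
    (hC : ∀ (m n : ℕ) (s t : ℕ → ℝ),
      StrictMonoOn s (Set.Iic m) → s 0 = a₁ → s m = b₁ →
      StrictMonoOn t (Set.Iic n) → t 0 = a₂ → t n = b₂ →
      ∑ i ∈ Finset.range m, ∑ j ∈ Finset.range n,
        |g (s (i + 1), t (j + 1)) - g (s (i + 1), t j) - g (s i, t (j + 1)) + g (s i, t j)| ≤ C) :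
    eVariationOn (sectionMap g (Icc a₂ b₂)) (Icc a₁ b₁) ≤ ENNReal.ofReal C := by
  rw [eVariationOn_Icc_eq_iSup h₁]
  refine iSup_le fun S => ?_
  obtain ⟨m, s, hs, hs', hs0, hsm, hS⟩ := exists_net_netOf h₁ S
  rw [← hS, eVariationOn.image_range_of_monotone _ hs]
  simp_rw [edist_sectionMap, eVariationOn_Icc_eq_iSup h₂]
  -- The suprema over the nets in `t` commute with the sum over the net in `s`, because finite sets
  -- are directed and the variations increase with them.
  rw [ENNReal.finsetSum_iSup_of_monotone
    (f := fun i T => eVariationOn (fun t => g (s i, t) - g (s (i + 1), t)) (netOf a₂ b₂ T))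
    fun i T U hTU => eVariationOn.mono _ (Finset.coe_subset.2 (netOf_mono _ _ hTU))]
  refine iSup_le fun T => ?_
  obtain ⟨n, t, ht, ht', ht0, htn, hT⟩ := exists_net_netOf h₂ T
  simp_rw [← hT, eVariationOn.image_range_of_monotone _ ht]
  refine le_trans (le_of_eq ?_) (ENNReal.ofReal_le_ofReal (hC m n s t hs' hs0 hsm ht' ht0 htn))
  rw [ENNReal.ofReal_sum_of_nonneg fun i _ => Finset.sum_nonneg fun j _ => abs_nonneg _]
  refine Finset.sum_congr rfl fun i _ => ?_
  rw [ENNReal.ofReal_sum_of_nonneg fun j _ => abs_nonneg _]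
  refine Finset.sum_congr rfl fun j _ => ?_
  rw [edist_dist, Real.dist_eq]
  congr 2
  ring

/-- One section of bounded variation in each direction suffices: sections differ by functions whose
variation is at most the joint variation. -/
theorem IsBVF.hardyOn {g : ℝ × ℝ → ℝ} {a₁ b₁ a₂ b₂ : ℝ} (h : IsBVF g a₁ b₁ a₂ b₂) :
    HardyOn g (Icc a₁ b₁) (Icc a₂ b₂) := by
  obtain ⟨C, hC⟩ := h.nets
  obtain ⟨s₀, hs₀, hsv⟩ := h.section_snd
  obtain ⟨t₀, ht₀, htv⟩ := h.section_fst
  have hj : BoundedVariationOn (sectionMap g (Icc a₂ b₂)) (Icc a₁ b₁) :=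
    ne_top_of_le_ne_top ENNReal.ofReal_ne_top
      (eVariationOn_sectionMap_le (hs₀.1.trans hs₀.2) (ht₀.1.trans ht₀.2) hC)
  refine ⟨hj, fun s hs => ?_, fun t ht => ?_⟩
  · have h1 : eVariationOn (fun t => g (s, t) - g (s₀, t)) (Icc a₂ b₂) ≠ ⊤ :=
      ne_top_of_le_ne_top hj (eVariationOn.edist_le (sectionMap g (Icc a₂ b₂)) hs hs₀)
    refine ne_top_of_le_ne_top (ENNReal.add_ne_top.2 ⟨h1, hsv⟩)
      (le_trans (le_of_eq ?_) (eVariationOn_add_le _ _ _))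
    congr 1
    ext t
    simp
  · have h1 : eVariationOn (fun s => g (s, t) - g (s, t₀)) (Icc a₁ b₁) ≠ ⊤ := by
      refine ne_top_of_le_ne_top hj (iSup_le fun ⟨n, u, hu, hmem⟩ => ?_)
      exact (Finset.sum_le_sum fun i _ => edist_sub_sub_le_edist_sectionMap g ht ht₀ _ _).trans
        (eVariationOn.sum_le hu hmem)
    refine ne_top_of_le_ne_top (ENNReal.add_ne_top.2 ⟨h1, htv⟩)
      (le_trans (le_of_eq ?_) (eVariationOn_add_le _ _ _))
    congr 1
    ext s
    simp

theorem eVariationOn_comp_le {E : Type*} [PseudoEMetricSpace E] (F : ℝ → E) {φ : ℝ → ℝ}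
    {S S' : Set ℝ} (hφ : MonotoneOn φ S' ∨ AntitoneOn φ S') (hm : MapsTo φ S' S) :
    eVariationOn (F ∘ φ) S' ≤ eVariationOn F S :=
  hφ.elim (fun h => eVariationOn.comp_le_of_monotoneOn F φ h hm)
    fun h => eVariationOn.comp_le_of_antitoneOn F φ h hm

/-- Bounded variation is preserved by monotone and antitone changes of the two variables; this
covers the restriction to a subrectangle and the reflections. -/
theorem HardyOn.comp {g : ℝ × ℝ → ℝ} {S T S' T' : Set ℝ} (h : HardyOn g S T) {φ ψ : ℝ → ℝ}
    (hφ : MonotoneOn φ S' ∨ AntitoneOn φ S') (hφm : MapsTo φ S' S)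
    (hψ : MonotoneOn ψ T' ∨ AntitoneOn ψ T') (hψm : MapsTo ψ T' T) :
    HardyOn (fun p => g (φ p.1, ψ p.2)) S' T' where
  joint := by
    refine ne_top_of_le_ne_top h.joint (le_trans ?_ (eVariationOn_comp_le _ hφ hφm))
    refine iSup_le fun ⟨n, u, hu, hmem⟩ => ?_
    refine (Finset.sum_le_sum fun i _ => ?_).trans (eVariationOn.sum_le hu hmem)
    exact eVariationOn_comp_le (fun t => g (φ (u (i + 1)), t) - g (φ (u i), t)) hψ hψm
  snd s hs := ne_top_of_le_ne_top (h.snd _ (hφm hs)) (eVariationOn_comp_le _ hψ hψm)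
  fst t ht := ne_top_of_le_ne_top (h.fst _ (hψm ht)) (eVariationOn_comp_le _ hφ hφm)

theorem eventually_eVariationOn_Ioc_le {E : Type*} [PseudoEMetricSpace E] {F : ℝ → E} {a : ℝ}
    (ha : 0 < a) (hF : BoundedVariationOn F (Ioc 0 a)) {ε : ℝ} (hε : 0 < ε) :
    ∀ᶠ δ in 𝓝[>] (0 : ℝ), eVariationOn F (Ioc 0 δ) ≤ ENNReal.ofReal ε := by
  have h := hF.tendsto_eVariationOn_Ioc_zero 0
  rw [nhdsWithin_Ioc_eq_nhdsGT ha] at h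
  filter_upwards [h.eventually_le_const (ENNReal.ofReal_pos.2 hε), Ioc_mem_nhdsGT ha] with δ hδ hδa
  rwa [inter_eq_self_of_subset_right (Ioc_subset_Ioc_right hδa.2)] at hδ

section Corner

variable {g : ℝ × ℝ → ℝ} {a b : ℝ}

/-- The sections `g (·, t)` oscillate little near `0`, uniformly in `t`. -/
theorem abs_sub_le_of_eVariationOn_sectionMap_le {δ ε : ℝ} (hb : 0 < b) (hε : 0 ≤ ε)
    (h1 : eVariationOn (sectionMap g (Ioc 0 b)) (Ioc 0 δ) ≤ ENNReal.ofReal ε)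
    (h2 : eVariationOn (fun s => g (s, b)) (Ioc 0 δ) ≤ ENNReal.ofReal ε)
    {s s' t : ℝ} (hs : s ∈ Ioc 0 δ) (hs' : s' ∈ Ioc 0 δ) (ht : t ∈ Ioc 0 b) :
    |g (s, t) - g (s', t)| ≤ 2 * ε := by
  have hbb : b ∈ Ioc 0 b := ⟨hb, le_rfl⟩
  have e1 := (edist_sub_sub_le_edist_sectionMap g ht hbb s s').trans
    ((eVariationOn.edist_le (sectionMap g (Ioc 0 b)) hs hs').trans h1)
  have e2 := (eVariationOn.edist_le (fun s => g (s, b)) hs hs').trans h2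
  rw [edist_dist, ENNReal.ofReal_le_ofReal_iff hε, Real.dist_eq] at e1 e2
  have := abs_le.1 e1
  have := abs_le.1 e2
  exact abs_le.2 ⟨by linarith, by linarith⟩

/-- A function of bounded variation in the sense of Hardy has a double limit at a corner: for `s`
close to `0` its values are close to those on one fixed section, which has a one-sided limit. -/
theorem HardyOn.exists_tendsto (h : HardyOn g (Ioc 0 a) (Ioc 0 b)) (ha : 0 < a) (hb : 0 < b) :
    ∃ L, Tendsto g (𝓝[>] 0 ×ˢ 𝓝[>] 0) (𝓝 L) := by
  refine CompleteSpace.complete (Metric.cauchy_iff.2 ⟨by infer_instance, fun ε hε => ?_⟩)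
  have hbb : b ∈ Ioc 0 b := ⟨hb, le_rfl⟩
  have hε' : 0 < ε / 8 := by positivity
  obtain ⟨δ, ⟨⟨h1, h2⟩, hδ⟩⟩ := ((eventually_eVariationOn_Ioc_le ha h.joint hε').and
    (eventually_eVariationOn_Ioc_le ha (h.fst b hbb) hε') |>.and (Ioc_mem_nhdsGT ha)).exists
  have hδδ : δ ∈ Ioc 0 δ := ⟨hδ.1, le_rfl⟩
  obtain ⟨κ, hκ1, hκ⟩ := ((eventually_eVariationOn_Ioc_le hb (h.snd δ hδ) hε').and
    (Ioc_mem_nhdsGT hb)).exists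
  refine ⟨g '' (Ioc 0 δ ×ˢ Ioc 0 κ), image_mem_map
    (prod_mem_prod (Ioc_mem_nhdsGT hδ.1) (Ioc_mem_nhdsGT hκ.1)), ?_⟩
  rintro _ ⟨⟨s, t⟩, ⟨hs, ht⟩, rfl⟩ _ ⟨⟨s', t'⟩, ⟨hs', ht'⟩, rfl⟩
  simp only at hs ht hs' ht'
  have b1 := abs_le.1 (abs_sub_le_of_eVariationOn_sectionMap_le hb hε'.le h1 h2 hs hδδ
    (Ioc_subset_Ioc_right hκ.2 ht))
  have b2 := abs_le.1 (abs_sub_le_of_eVariationOn_sectionMap_le hb hε'.le h1 h2 hs' hδδ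
    (Ioc_subset_Ioc_right hκ.2 ht'))
  have b3 := (eVariationOn.edist_le (fun t => g (δ, t)) ht ht').trans hκ1
  rw [edist_dist, ENNReal.ofReal_le_ofReal_iff hε'.le, Real.dist_eq] at b3
  have b3' := abs_le.1 b3
  rw [Real.dist_eq]
  exact abs_lt.2 ⟨by linarith, by linarith⟩

/-- Integrating out the second variable against a kernel with bounded primitives turns a function
of bounded variation in the sense of Hardy into one of bounded variation. -/
theorem HardyOn.eVariationOn_integral_le (h : HardyOn g (Ioc 0 a) (Ioc 0 b)) (hb : 0 < b)
    {S : Set ℝ} (hS : S ⊆ Ioc 0 a) {ψ : ℝ → ℝ} (hψ : Continuous ψ) {K : ℝ}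
    (hK : ∀ e ∈ Icc 0 b, |∫ x in e..b, ψ x| ≤ K) :
    eVariationOn (fun s => ∫ t in (0 : ℝ)..b, g (s, t) * ψ t) S ≤
      ENNReal.ofReal K * (eVariationOn (fun s => g (s, b)) S +
        4 * eVariationOn (sectionMap g (Ioc 0 b)) S) := by
  have hK0 : 0 ≤ K := (abs_nonneg _).trans (hK b ⟨hb.le, le_rfl⟩)
  refine iSup_le fun ⟨n, u, hu, hmem⟩ => ?_
  have key : ∀ s ∈ Ioc 0 a, ∀ s' ∈ Ioc 0 a,
      edist (∫ t in (0 : ℝ)..b, g (s, t) * ψ t) (∫ t in (0 : ℝ)..b, g (s', t) * ψ t) ≤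
        ENNReal.ofReal K * (edist (g (s, b)) (g (s', b)) +
          4 * edist (sectionMap g (Ioc 0 b) s) (sectionMap g (Ioc 0 b) s')) := by
    intro s hs s' hs'
    have hbv : BoundedVariationOn (fun t => g (s, t) - g (s', t)) (Ioc 0 b) :=
      ne_top_of_le_ne_top h.joint (eVariationOn.edist_le (sectionMap g (Ioc 0 b)) hs hs')
    have i1 := ((h.snd s hs).intervalIntegrable_of_Ioc hb.le).mul_continuousOn hψ.continuousOn
    have i2 := ((h.snd s' hs').intervalIntegrable_of_Ioc hb.le).mul_continuousOn hψ.continuousOn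
    have e := abs_integral_mul_le hb hbv hψ hK
    simp_rw [sub_mul] at e
    rw [intervalIntegral.integral_sub i1 i2] at e
    rw [edist_sectionMap, edist_dist, Real.dist_eq, edist_dist, Real.dist_eq,
      ← ENNReal.ofReal_toReal hbv]
    refine (ENNReal.ofReal_le_ofReal e).trans (le_of_eq ?_)
    rw [ENNReal.ofReal_mul hK0, ENNReal.ofReal_add (abs_nonneg _) (by positivity),
      ENNReal.ofReal_mul (by norm_num)]
    simp
  refine (Finset.sum_le_sum fun i _ => key _ (hS (hmem _)) _ (hS (hmem _))).trans ?_
  rw [← Finset.mul_sum, Finset.sum_add_distrib, ← Finset.mul_sum]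
  gcongr
  · exact eVariationOn.sum_le (f := fun s => g (s, b)) hu hmem
  · exact eVariationOn.sum_le hu hmem

/-- The Dirichlet–Jordan theorem at the left endpoint of `(0, b]`, for a single function. -/
theorem tendsto_integral_mul_dirichletKernel_of_tendsto {φ : ℝ → ℝ} {l : ℝ} (hb : 0 < b)
    (hφ : BoundedVariationOn φ (Ioc 0 b)) (hl : Tendsto φ (𝓝[>] 0) (𝓝 l)) :
    Tendsto (fun N => ∫ t in (0 : ℝ)..b, φ t * dirichletKernel N t) atTop (𝓝 (l / 2)) := by
  have h := tendsto_integral_mul_dirichletKernel (ι := Unit) (F := pure ()) (H := fun _ => φ)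
    (a := b) (l := l) (C := max (eVariationOn φ (Ioc 0 b)).toReal |φ b|)
    (fun _ => (ENNReal.ofReal_toReal hφ).ge.trans (ENNReal.ofReal_le_ofReal (le_max_left _ _)))
    (fun _ => le_max_right _ _)
    (fun ε hε => by
      obtain ⟨δ, ⟨h1, h2⟩, h3⟩ := ((eventually_eVariationOn_Ioc_le hb hφ hε).and
        (hl.eventually (Metric.closedBall_mem_nhds l hε)) |>.and (Ioc_mem_nhdsGT hb)).exists
      exact ⟨δ, h3, fun _ => h1, Eventually.of_forall fun _ => h2⟩)
  exact h.comp (tendsto_const_pure.prodMk tendsto_id)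

/-- The Dirichlet–Jordan theorem at a corner of a rectangle. -/
theorem HardyOn.tendsto_integral_integral (h : HardyOn g (Ioc 0 a) (Ioc 0 b)) (ha : 0 < a)
    (hb : 0 < b) {L : ℝ} (hL : Tendsto g (𝓝[>] 0 ×ˢ 𝓝[>] 0) (𝓝 L)) :
    Tendsto (fun q : ℝ × ℝ => ∫ s in (0 : ℝ)..a,
      (∫ t in (0 : ℝ)..b, g (s, t) * dirichletKernel q.1 t) * dirichletKernel q.2 s)
      (atTop ×ˢ atTop) (𝓝 (L / 4)) := by
  obtain ⟨K, hK0, hK⟩ := exists_bound_integral_dirichletKernel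
  have hbb : b ∈ Ioc 0 b := ⟨hb, le_rfl⟩
  have haa : a ∈ Ioc 0 a := ⟨ha, le_rfl⟩
  have hK' : ∀ N : Ici (0 : ℝ), ∀ e ∈ Icc 0 b, |∫ x in e..b, dirichletKernel N x| ≤ K :=
    fun N e he => hK N e b N.2 he.1 hb.le
  -- The kernels have bounded primitives only for nonnegative parameters.
  let H : Ici (0 : ℝ) → ℝ → ℝ := fun N s => ∫ t in (0 : ℝ)..b, g (s, t) * dirichletKernel N t
  have hvar : ∀ δ ≤ a, ∀ ε : ℝ, eVariationOn (fun s => g (s, b)) (Ioc 0 δ) ≤ ENNReal.ofReal ε →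
      eVariationOn (sectionMap g (Ioc 0 b)) (Ioc 0 δ) ≤ ENNReal.ofReal ε → 0 ≤ ε →
      ∀ N : Ici (0 : ℝ), eVariationOn (H N) (Ioc 0 δ) ≤ ENNReal.ofReal (5 * K * ε) := by
    intro δ hδ ε h1 h2 hε N
    refine (h.eVariationOn_integral_le hb (Ioc_subset_Ioc_right hδ)
      (continuous_dirichletKernel N) (hK' N)).trans ?_
    calc _ ≤ ENNReal.ofReal K * (ENNReal.ofReal ε + 4 * ENNReal.ofReal ε) := by gcongr
      _ = ENNReal.ofReal (5 * K * ε) := by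
        rw [show (4 : ℝ≥0∞) = ENNReal.ofReal 4 by simp, ← ENNReal.ofReal_mul (by norm_num),
          ← ENNReal.ofReal_add hε (by positivity), ← ENNReal.ofReal_mul hK0.le]
        ring_nf
  have hlimsec : ∀ s ∈ Ioc 0 a, ∃ l, Tendsto (fun t => g (s, t)) (𝓝[>] 0) (𝓝 l) := fun s hs => by
    obtain ⟨l, hl⟩ := (h.snd s hs).exists_tendsto_right 0
    refine ⟨l, ?_⟩
    rwa [show Ioc 0 b ∩ Ioi (0 : ℝ) = Ioc 0 b from inter_eq_left.2 fun x hx => hx.1,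
      nhdsWithin_Ioc_eq_nhdsGT hb] at hl
  set V1 := (eVariationOn (fun s => g (s, b)) (Ioc 0 a)).toReal
  set V2 := (eVariationOn (sectionMap g (Ioc 0 b)) (Ioc 0 a)).toReal
  set V3 := (eVariationOn (fun t => g (a, t)) (Ioc 0 b)).toReal
  have main := tendsto_integral_mul_dirichletKernel (F := atTop) (H := H) (a := a) (l := L / 2)
    (C := max (5 * K * max V1 V2) (K * (|g (a, b)| + 4 * V3)))
    (fun N => (hvar a le_rfl (max V1 V2)
      ((ENNReal.ofReal_toReal (h.fst b hbb)).ge.trans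
        (ENNReal.ofReal_le_ofReal (le_max_left _ _)))
      ((ENNReal.ofReal_toReal h.joint).ge.trans (ENNReal.ofReal_le_ofReal (le_max_right _ _)))
      (ENNReal.toReal_nonneg.trans (le_max_left _ _)) N).trans
        (ENNReal.ofReal_le_ofReal (le_max_left _ _)))
    (fun N => (abs_integral_mul_le hb (h.snd a haa) (continuous_dirichletKernel N)
      (hK' N)).trans (le_max_right _ _))
    (fun ε hε => by
      have hε' : 0 < ε / (5 * K) := by positivity
      have hL' : ∀ᶠ s in 𝓝[>] (0 : ℝ), ∀ᶠ t in 𝓝[>] (0 : ℝ), dist (g (s, t)) L ≤ ε :=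
        (hL.eventually (Metric.closedBall_mem_nhds L hε)).curry
      obtain ⟨δ, ⟨⟨h1, h2⟩, h3⟩, hδ⟩ := ((eventually_eVariationOn_Ioc_le ha h.joint hε').and
        (eventually_eVariationOn_Ioc_le ha (h.fst b hbb) hε') |>.and hL' |>.and
        (Ioc_mem_nhdsGT ha)).exists
      refine ⟨δ, hδ, fun N => ?_, ?_⟩
      · have := hvar δ hδ.2 _ h2 h1 hε'.le N
        rwa [mul_div_cancel₀ _ (by positivity : 5 * K ≠ 0)] at this
      · obtain ⟨l, hl⟩ := hlimsec δ hδ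
        have hlL : dist l L ≤ ε := le_of_tendsto (hl.dist tendsto_const_nhds) h3
        have hc := tendsto_integral_mul_dirichletKernel_of_tendsto hb (h.snd δ hδ) hl
        have hc' : Tendsto (fun N : Ici (0 : ℝ) => H N δ) atTop (𝓝 (l / 2)) :=
          tendsto_comp_val_Ici_atTop.2 hc
        filter_upwards [hc'.eventually (Metric.closedBall_mem_nhds (l / 2) (half_pos hε))]
          with N hN
        rw [Real.dist_eq] at hN
        rw [Real.dist_eq] at hlL
        have := abs_le.1 hN
        have := abs_le.1 hlL
        exact abs_le.2 ⟨by linarith, by linarith⟩)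
  rw [show L / 2 / 2 = L / 4 by ring] at main
  have hmap : (atTop ×ˢ atTop : Filter (ℝ × ℝ)) =
      map (Prod.map ((↑) : Ici (0 : ℝ) → ℝ) id) (atTop ×ˢ atTop) := by
    rw [← prod_map_map_eq', map_val_Ici_atTop, map_id]
  rw [hmap, tendsto_map'_iff]
  exact main

end Corner

/-! ### Riemann–Lebesgue estimates away from the center -/

/-- The real form of the Riemann–Lebesgue lemma, along any frequencies tending to infinity. -/
theorem tendsto_integral_cos_sin_of_tendsto_cocompact {V ι : Type*} [NormedAddCommGroup V]
    [NormedSpace ℝ V] [FiniteDimensional ℝ V] [MeasurableSpace V] [BorelSpace V] {μ : Measure V}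
    [μ.IsAddHaarMeasure] {h : V → ℝ} (hh : Integrable h μ) {F : Filter ι}
    {w : ι → StrongDual ℝ V} (hw : Tendsto w F (cocompact _)) :
    Tendsto (fun i => ∫ v, h v * cos (2 * π * w i v) ∂μ) F (𝓝 0) ∧
      Tendsto (fun i => ∫ v, h v * sin (2 * π * w i v) ∂μ) F (𝓝 0) := by
  have hlim := (tendsto_integral_exp_smul_cocompact (fun v => (h v : ℂ)) μ).comp hw
  have hval : ∀ (i : ι) (v : V), (fourierChar (-w i v) : Circle) • (h v : ℂ) =
      ((h v * cos (2 * π * w i v) : ℝ) : ℂ) -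
        ((h v * sin (2 * π * w i v) : ℝ) : ℂ) * Complex.I := by
    intro i v
    rw [Circle.smul_def, Real.fourierChar_apply, smul_eq_mul, mul_neg, Complex.ofReal_neg,
      neg_mul, ← neg_mul, ← Complex.ofReal_neg, Complex.exp_mul_I, ← Complex.ofReal_cos,
      ← Complex.ofReal_sin, cos_neg, sin_neg]
    push_cast
    ring
  have hcont : ∀ i, Continuous fun v => 2 * π * w i v := fun i =>
    continuous_const.mul (w i).continuous
  have hc : ∀ i, Integrable (fun v => h v * cos (2 * π * w i v)) μ := fun i =>
    hh.mul_bdd (c := 1) (continuous_cos.comp (hcont i)).aestronglyMeasurable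
      (Eventually.of_forall fun v => abs_cos_le_one _)
  have hs : ∀ i, Integrable (fun v => h v * sin (2 * π * w i v)) μ := fun i =>
    hh.mul_bdd (c := 1) (continuous_sin.comp (hcont i)).aestronglyMeasurable
      (Eventually.of_forall fun v => abs_sin_le_one _)
  have hint : ∀ i, Integrable (fun v => (fourierChar (-w i v) : Circle) • (h v : ℂ)) μ := by
    intro i
    simp_rw [hval]
    exact (hc i).ofReal.sub ((hs i).ofReal.mul_const _)
  constructor
  · have := (Complex.continuous_re.tendsto 0).comp hlim
    simp only [Complex.zero_re] at this
    refine this.congr fun i => ?_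
    simp only [Function.comp_apply]
    rw [← RCLike.re_eq_complex_re, ← integral_re (hint i)]
    simp only [hval, RCLike.re_eq_complex_re, Complex.sub_re, Complex.ofReal_re,
      Complex.re_ofReal_mul, Complex.I_re, mul_zero, sub_zero]
  · have := ((Complex.continuous_im.tendsto 0).comp hlim).neg
    simp only [Complex.zero_im, neg_zero] at this
    refine this.congr fun i => ?_
    simp only [Function.comp_apply]
    rw [← RCLike.im_eq_complex_im, ← integral_im (hint i), ← integral_neg]
    simp only [hval, RCLike.im_eq_complex_im, Complex.sub_im, Complex.ofReal_im,
      Complex.im_ofReal_mul, Complex.I_im, mul_one, zero_sub, neg_neg]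

/-- The product of sines is a difference of cosines with frequencies `(M, -N)` and `(M, N)`, both of
which leave every compact set. -/
theorem tendsto_integral_mul_sin_mul_sin {h : ℝ × ℝ → ℝ} (hh : Integrable h) :
    Tendsto (fun q : ℝ × ℝ => ∫ p, h p * (sin (q.2 * p.1) * sin (q.1 * p.2)))
      (atTop ×ˢ atTop) (𝓝 0) := by
  let w : ℝ → ℝ × ℝ → StrongDual ℝ (ℝ × ℝ) := fun c q =>
    (q.2 / (2 * π)) • ContinuousLinearMap.fst ℝ ℝ ℝ +
      (c * q.1 / (2 * π)) • ContinuousLinearMap.snd ℝ ℝ ℝ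
  have hw : ∀ c, Tendsto (w c) (atTop ×ˢ atTop) (cocompact _) := by
    intro c
    rw [← Metric.cobounded_eq_cocompact, ← tendsto_norm_atTop_iff_cobounded]
    have h2 : Tendsto (fun q : ℝ × ℝ => q.2 / (2 * π)) (atTop ×ˢ atTop) atTop :=
      tendsto_snd.atTop_div_const (by positivity)
    refine tendsto_atTop_mono (fun q => ?_) h2
    have := (w c q).le_opNorm (1, 0)
    simp only [w, _root_.add_apply, _root_.smul_apply,
      ContinuousLinearMap.coe_fst', ContinuousLinearMap.coe_snd', smul_eq_mul, mul_one, mul_zero,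
      add_zero, Prod.norm_mk, norm_one, norm_zero] at this
    rw [max_eq_left zero_le_one, mul_one] at this
    exact (le_abs_self _).trans this
  have hval : ∀ c q p, 2 * π * w c q p = q.2 * p.1 + c * (q.1 * p.2) := by
    intro c q p
    simp only [w, _root_.add_apply, _root_.smul_apply,
      ContinuousLinearMap.coe_fst', ContinuousLinearMap.coe_snd', smul_eq_mul]
    field_simp
  have hi : ∀ c q, Integrable (fun p => h p * cos (2 * π * w c q p)) := fun c q =>
    hh.mul_bdd (c := 1) (by fun_prop) (Eventually.of_forall fun p => abs_cos_le_one _)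
  have h1 := (tendsto_integral_cos_sin_of_tendsto_cocompact (μ := volume) hh (hw (-1))).1
  have h2 := (tendsto_integral_cos_sin_of_tendsto_cocompact (μ := volume) hh (hw 1)).1
  have := (h1.sub h2).div_const 2
  simp only [sub_self, zero_div] at this
  refine this.congr fun q => ?_
  rw [← integral_sub (hi _ _) (hi _ _), ← integral_div]
  congr 1
  ext p
  rw [hval, hval, neg_one_mul, one_mul, cos_add, cos_add, cos_neg, sin_neg]
  ring

theorem tendsto_integral_mul_sin {h : ℝ → ℝ} (hh : Integrable h) :
    Tendsto (fun N : ℝ => ∫ t, h t * sin (N * t)) atTop (𝓝 0) := by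
  let w : ℝ → StrongDual ℝ ℝ := fun N => (N / (2 * π)) • ContinuousLinearMap.id ℝ ℝ
  have hw : Tendsto w atTop (cocompact _) := by
    rw [← Metric.cobounded_eq_cocompact, ← tendsto_norm_atTop_iff_cobounded]
    refine tendsto_atTop_mono (fun N => ?_) (tendsto_id.atTop_div_const two_pi_pos)
    have := (w N).le_opNorm 1
    simp only [w, _root_.smul_apply, ContinuousLinearMap.id_apply, smul_eq_mul,
      mul_one, norm_one] at this
    exact (le_abs_self _).trans this
  refine (tendsto_integral_cos_sin_of_tendsto_cocompact (μ := volume) hh hw).2.congr fun N => ?_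
  congr 1
  ext t
  simp only [w, _root_.smul_apply, ContinuousLinearMap.id_apply, smul_eq_mul]
  congr 2
  field_simp

/-- The Riemann–Lebesgue lemma for the product Dirichlet kernel on regions where the singular
factor `1 / (s t)` is integrated together with the function. -/
theorem tendsto_setIntegral_mul_dirichletKernel_of_integrableOn {G : ℝ × ℝ → ℝ} {S : Set (ℝ × ℝ)}
    (hS : MeasurableSet S) (hS0 : ∀ p ∈ S, p.1 ≠ 0 ∧ p.2 ≠ 0)
    (hG : IntegrableOn (fun p => G p * (p.1⁻¹ * p.2⁻¹)) S) :
    Tendsto (fun q : ℝ × ℝ => ∫ p in S, G p * (dirichletKernel q.2 p.1 * dirichletKernel q.1 p.2))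
      (atTop ×ˢ atTop) (𝓝 0) := by
  have h := (tendsto_integral_mul_sin_mul_sin
    ((integrable_indicator_iff hS).2 hG)).const_mul (π⁻¹ * π⁻¹)
  rw [mul_zero] at h
  refine h.congr fun q => ?_
  rw [← integral_const_mul, ← integral_indicator hS]
  congr 1
  ext p
  by_cases hp : p ∈ S
  · simp only [indicator_of_mem hp]
    rw [dirichletKernel_of_ne_zero _ (hS0 p hp).1, dirichletKernel_of_ne_zero _ (hS0 p hp).2]
    ring
  · simp [indicator_of_notMem hp]

theorem integrableOn_mul_dirichletKernel {G : ℝ × ℝ → ℝ} {S : Set (ℝ × ℝ)}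
    (hG : IntegrableOn G S) (M N : ℝ) :
    IntegrableOn (fun p => G p * (dirichletKernel M p.1 * dirichletKernel N p.2)) S := by
  refine Integrable.mul_bdd (c := |M| / π * (|N| / π)) hG
    (by fun_prop : Continuous fun p : ℝ × ℝ =>
      dirichletKernel M p.1 * dirichletKernel N p.2).aestronglyMeasurable
    (Eventually.of_forall fun p => ?_)
  rw [norm_mul]
  exact mul_le_mul (abs_dirichletKernel_le _ _) (abs_dirichletKernel_le _ _) (norm_nonneg _)
    (by positivity)

theorem integrable_inv_mul_bdd_of_lt {G : ℝ × ℝ → ℝ} {S : Set (ℝ × ℝ)} (hS : MeasurableSet S)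
    (hG : IntegrableOn G S) {φ : ℝ × ℝ → ℝ} (hφ : Measurable φ) {ε : ℝ} (hε : 0 < ε)
    (hSφ : ∀ p ∈ S, ε < φ p) : IntegrableOn (fun p => G p * (φ p)⁻¹) S := by
  refine Integrable.mul_bdd (c := ε⁻¹) hG hφ.inv.aestronglyMeasurable ?_
  filter_upwards [ae_restrict_mem hS] with p hp
  have := hSφ p hp
  rw [norm_inv, Real.norm_eq_abs, abs_of_pos (hε.trans this)]
  gcongr

section Arms

variable {G : ℝ × ℝ → ℝ} {ε₁ ε₂ : ℝ}

theorem tendsto_setIntegral_far (hε₁ : 0 < ε₁) (hε₂ : 0 < ε₂)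
    (hG : IntegrableOn G (Ioi ε₁ ×ˢ Ioi ε₂)) :
    Tendsto (fun q : ℝ × ℝ => ∫ p in Ioi ε₁ ×ˢ Ioi ε₂,
      G p * (dirichletKernel q.2 p.1 * dirichletKernel q.1 p.2)) (atTop ×ˢ atTop) (𝓝 0) := by
  have hm : MeasurableSet (Ioi ε₁ ×ˢ Ioi ε₂) := measurableSet_Ioi.prod measurableSet_Ioi
  refine tendsto_setIntegral_mul_dirichletKernel_of_integrableOn hm
    (fun p hp => ⟨(hε₁.trans hp.1).ne', (hε₂.trans hp.2).ne'⟩) ?_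
  have h1 := integrable_inv_mul_bdd_of_lt hm hG measurable_fst hε₁ fun p hp => hp.1
  have h2 := integrable_inv_mul_bdd_of_lt hm h1 measurable_snd hε₂ fun p hp => hp.2
  simpa only [mul_assoc] using h2

/-- On an arm of the cross the function is replaced by a function `α` of the variable along the
arm, up to an error that is controlled by the Riemann–Lebesgue lemma; for `α` the integral splits
into a bounded factor and a factor tending to zero. -/
theorem tendsto_setIntegral_arm (hε₁ : 0 < ε₁) (hε₂ : 0 < ε₂)
    (hG : IntegrableOn G (Ioc 0 ε₁ ×ˢ Ioi ε₂)) {α : ℝ → ℝ} (hα : Integrable α)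
    (hGα : IntegrableOn (fun p => p.1⁻¹ * (G p - α p.2)) (Ioc 0 ε₁ ×ˢ Ioi ε₂)) :
    Tendsto (fun q : ℝ × ℝ => ∫ p in Ioc 0 ε₁ ×ˢ Ioi ε₂,
      G p * (dirichletKernel q.2 p.1 * dirichletKernel q.1 p.2)) (atTop ×ˢ atTop) (𝓝 0) := by
  set S := Ioc 0 ε₁ ×ˢ Ioi ε₂
  have hm : MeasurableSet S := measurableSet_Ioc.prod measurableSet_Ioi
  have hαS : IntegrableOn (fun p : ℝ × ℝ => α p.2) S := by
    have h1 : Integrable (fun _ : ℝ => (1 : ℝ)) (volume.restrict (Ioc 0 ε₁)) :=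
      integrable_const _
    have := h1.mul_prod (hα.integrableOn (s := Ioi ε₂))
    rw [Measure.prod_restrict, ← Measure.volume_eq_prod] at this
    simp only [one_mul] at this
    exact this
  have h1 : Tendsto (fun q : ℝ × ℝ => ∫ p in S,
      (G p - α p.2) * (dirichletKernel q.2 p.1 * dirichletKernel q.1 p.2))
      (atTop ×ˢ atTop) (𝓝 0) := by
    refine tendsto_setIntegral_mul_dirichletKernel_of_integrableOn hm
      (fun p hp => ⟨hp.1.1.ne', (hε₂.trans hp.2).ne'⟩) ?_
    refine (integrable_inv_mul_bdd_of_lt hm hGα measurable_snd hε₂ fun p hp => hp.2).congr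
      (Eventually.of_forall fun p => ?_)
    simp only
    ring
  have h2 : Tendsto (fun N : ℝ => ∫ t in Ioi ε₂, α t * dirichletKernel N t) atTop (𝓝 0) := by
    have hi : IntegrableOn (fun t => α t * t⁻¹) (Ioi ε₂) := by
      refine Integrable.mul_bdd (c := ε₂⁻¹) hα.integrableOn
        measurable_inv.aestronglyMeasurable ?_
      filter_upwards [ae_restrict_mem measurableSet_Ioi] with t ht
      have ht' : ε₂ < t := ht
      rw [norm_inv, Real.norm_eq_abs, abs_of_pos (hε₂.trans ht')]
      gcongr
    have h := (tendsto_integral_mul_sin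
      ((integrable_indicator_iff measurableSet_Ioi).2 hi)).const_mul π⁻¹
    rw [mul_zero] at h
    refine h.congr fun N => ?_
    rw [← integral_const_mul, ← integral_indicator measurableSet_Ioi]
    congr 1
    ext t
    by_cases ht : t ∈ Ioi ε₂
    · simp only [indicator_of_mem ht]
      rw [dirichletKernel_of_ne_zero _ (hε₂.trans ht).ne']
      ring
    · simp [indicator_of_notMem ht]
  have h3 := ((tendsto_integral_dirichletKernel hε₁).comp
    (tendsto_snd (f := (atTop : Filter ℝ)))).mul (h2.comp (tendsto_fst (g := (atTop : Filter ℝ))))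
  have h4 := h1.add h3
  simp only [mul_zero, add_zero] at h4
  refine h4.congr fun q => ?_
  simp only [Function.comp_apply]
  have e : ∫ p in S, α p.2 * (dirichletKernel q.2 p.1 * dirichletKernel q.1 p.2) =
      (∫ s in (0 : ℝ)..ε₁, dirichletKernel q.2 s) *
        ∫ t in Ioi ε₂, α t * dirichletKernel q.1 t := by
    rw [intervalIntegral.integral_of_le hε₁.le, ← setIntegral_prod_mul]
    refine setIntegral_congr_fun hm fun p _ => ?_
    ring
  rw [← e, ← integral_add]
  · congr 1
    ext p
    ring
  · exact integrableOn_mul_dirichletKernel (G := fun p => G p - α p.2) (hG.sub hαS) _ _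
  · exact integrableOn_mul_dirichletKernel (G := fun p => α p.2) hαS _ _

/-- The estimate on the other arm of the cross follows by exchanging the variables. -/
theorem tendsto_setIntegral_arm' (hε₁ : 0 < ε₁) (hε₂ : 0 < ε₂)
    (hG : IntegrableOn G (Ioi ε₁ ×ˢ Ioc 0 ε₂)) {α : ℝ → ℝ} (hα : Integrable α)
    (hGα : IntegrableOn (fun p => p.2⁻¹ * (G p - α p.1)) (Ioi ε₁ ×ˢ Ioc 0 ε₂)) :
    Tendsto (fun q : ℝ × ℝ => ∫ p in Ioi ε₁ ×ˢ Ioc 0 ε₂,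
      G p * (dirichletKernel q.2 p.1 * dirichletKernel q.1 p.2)) (atTop ×ˢ atTop) (𝓝 0) := by
  have hs : ∀ {E : ℝ × ℝ → ℝ}, IntegrableOn E (Ioi ε₁ ×ˢ Ioc 0 ε₂) →
      IntegrableOn (fun p => E p.swap) (Ioc 0 ε₂ ×ˢ Ioi ε₁) := fun h => h.swap
  have h := (tendsto_setIntegral_arm (G := fun p => G p.swap) hε₂ hε₁ (hs hG) hα (hs hGα)).comp
    (tendsto_snd.prodMk tendsto_fst)
  refine h.congr fun q => ?_
  simp only [Function.comp_apply]
  rw [Measure.volume_eq_prod, ← setIntegral_prod_swap]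
  refine setIntegral_congr_fun (measurableSet_Ioi.prod measurableSet_Ioc) fun p _ => ?_
  simp only [Prod.swap]
  ring

end Arms

/-! ### Inversion for real functions -/

section Quadrants

theorem measurePreserving_add_mul (x : ℝ) {σ : ℝ} (hσ : σ = 1 ∨ σ = -1) :
    MeasurePreserving (fun s : ℝ => x + σ * s) volume volume := by
  rcases hσ with rfl | rfl
  · simpa using measurePreserving_add_left volume x
  · simpa [sub_eq_add_neg] using Measure.measurePreserving_sub_left volume x

theorem measurableEmbedding_add_mul (x : ℝ) {σ : ℝ} (hσ : σ = 1 ∨ σ = -1) :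
    MeasurableEmbedding (fun s : ℝ => x + σ * s) := by
  have h0 : σ ≠ 0 := by rcases hσ with rfl | rfl <;> norm_num
  exact (measurableEmbedding_addLeft x).comp (measurableEmbedding_mulLeft₀ h0)

/-- The isometry of the plane carrying the origin to `(x, y)` and the first quadrant to the
quadrant at `(x, y)` with signs `σ`, `τ`. -/
def quadrantMap (x y σ τ : ℝ) (p : ℝ × ℝ) : ℝ × ℝ := (x + σ * p.1, y + τ * p.2)

variable {x y σ τ : ℝ}

theorem measurePreserving_quadrantMap (hσ : σ = 1 ∨ σ = -1) (hτ : τ = 1 ∨ τ = -1) :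
    MeasurePreserving (quadrantMap x y σ τ) volume volume :=
  (measurePreserving_add_mul x hσ).prod (measurePreserving_add_mul y hτ)

theorem measurableEmbedding_quadrantMap (hσ : σ = 1 ∨ σ = -1) (hτ : τ = 1 ∨ τ = -1) :
    MeasurableEmbedding (quadrantMap x y σ τ) :=
  (measurableEmbedding_add_mul x hσ).prodMap (measurableEmbedding_add_mul y hτ)

theorem integrable_comp_quadrantMap {f : ℝ × ℝ → ℝ} (hf : Integrable f)
    (hσ : σ = 1 ∨ σ = -1) (hτ : τ = 1 ∨ τ = -1) :
    Integrable (fun p => f (quadrantMap x y σ τ p)) :=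
  (measurePreserving_quadrantMap hσ hτ).integrable_comp_of_integrable hf

theorem setIntegral_quadrantMap (f : ℝ × ℝ → ℝ) {A B : Set ℝ}
    (hσ : σ = 1 ∨ σ = -1) (hτ : τ = 1 ∨ τ = -1)
    (hA : (fun s => x + σ * s) ⁻¹' A =ᵐ[volume] Ioi (0 : ℝ))
    (hB : (fun s => y + τ * s) ⁻¹' B =ᵐ[volume] Ioi (0 : ℝ)) :
    ∫ p in A ×ˢ B, f p = ∫ p in Ioi 0 ×ˢ Ioi 0, f (quadrantMap x y σ τ p) := by
  rw [← (measurePreserving_quadrantMap hσ hτ).setIntegral_preimage_emb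
    (measurableEmbedding_quadrantMap hσ hτ) f (A ×ˢ B)]
  exact setIntegral_congr_set (Measure.set_prod_ae_eq hA hB)

theorem preimage_add_one_mul_Ioi (x : ℝ) :
    (fun s => x + 1 * s) ⁻¹' Ioi x =ᵐ[volume] Ioi (0 : ℝ) := by
  rw [show (fun s => x + 1 * s) ⁻¹' Ioi x = Ioi (0 : ℝ) by ext s; simp]
  exact EventuallyEq.rfl

theorem preimage_add_neg_one_mul_Iic (x : ℝ) :
    (fun s => x + -1 * s) ⁻¹' Iic x =ᵐ[volume] Ioi (0 : ℝ) := by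
  rw [show (fun s => x + -1 * s) ⁻¹' Iic x = Ici (0 : ℝ) by ext s; simp]
  exact Ioi_ae_eq_Ici.symm

theorem integral_eq_sum_quadrants {f : ℝ × ℝ → ℝ} (hf : Integrable f) (x y : ℝ) :
    ∫ p, f p = (∫ p in Ioi 0 ×ˢ Ioi 0, f (quadrantMap x y (-1) (-1) p)) +
      (∫ p in Ioi 0 ×ˢ Ioi 0, f (quadrantMap x y 1 1 p)) +
      (∫ p in Ioi 0 ×ˢ Ioi 0, f (quadrantMap x y (-1) 1 p)) +
      ∫ p in Ioi 0 ×ˢ Ioi 0, f (quadrantMap x y 1 (-1) p) := by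
  have hsplit : ∀ A : Set ℝ, MeasurableSet A → ∫ p in A ×ˢ univ, f p =
      (∫ p in A ×ˢ Iic y, f p) + ∫ p in A ×ˢ Ioi y, f p := fun A hA => by
    rw [← setIntegral_union _ (hA.prod measurableSet_Ioi) hf.integrableOn hf.integrableOn,
      ← prod_union, Iic_union_Ioi]
    exact disjoint_left.2 fun p h1 h2 => not_lt.2 (mem_Iic.1 h1.2) h2.2
  have h1 : ∫ p, f p = (∫ p in Iic x ×ˢ univ, f p) + ∫ p in Ioi x ×ˢ univ, f p := by
    rw [← setIntegral_union _ (measurableSet_Ioi.prod MeasurableSet.univ) hf.integrableOn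
      hf.integrableOn, ← union_prod, Iic_union_Ioi, univ_prod_univ, setIntegral_univ]
    exact disjoint_left.2 fun p h1 h2 => not_lt.2 (mem_Iic.1 h1.1) h2.1
  rw [h1, hsplit _ measurableSet_Iic, hsplit _ measurableSet_Ioi,
    setIntegral_quadrantMap f (.inr rfl) (.inr rfl) (preimage_add_neg_one_mul_Iic x)
      (preimage_add_neg_one_mul_Iic y),
    setIntegral_quadrantMap f (.inr rfl) (.inl rfl) (preimage_add_neg_one_mul_Iic x)
      (preimage_add_one_mul_Ioi y),
    setIntegral_quadrantMap f (.inl rfl) (.inr rfl) (preimage_add_one_mul_Ioi x)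
      (preimage_add_neg_one_mul_Iic y),
    setIntegral_quadrantMap f (.inl rfl) (.inl rfl) (preimage_add_one_mul_Ioi x)
      (preimage_add_one_mul_Ioi y)]
  ring

theorem IsBVF.hardyOn_quadrantMap {f : ℝ × ℝ → ℝ} {a b : ℝ}
    (h : IsBVF f (x - a) (x + a) (y - b) (y + b))
    (hσ : σ = 1 ∨ σ = -1) (hτ : τ = 1 ∨ τ = -1) :
    HardyOn (fun p => f (quadrantMap x y σ τ p)) (Ioc 0 a) (Ioc 0 b) := by
  have hmono : ∀ {z c σ : ℝ}, (σ = 1 ∨ σ = -1) → (MonotoneOn (fun s => z + σ * s) (Ioc 0 c) ∨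
      AntitoneOn (fun s => z + σ * s) (Ioc 0 c)) ∧
      MapsTo (fun s => z + σ * s) (Ioc 0 c) (Icc (z - c) (z + c)) := by
    rintro z c σ (rfl | rfl)
    · exact ⟨Or.inl fun s _ s' _ hss' => by simpa using hss',
        fun s hs => ⟨by linarith [hs.1, hs.2], by linarith [hs.1, hs.2]⟩⟩
    · exact ⟨Or.inr fun s _ s' _ hss' => show z + -1 * s' ≤ z + -1 * s by linarith,
        fun s hs => ⟨by linarith [hs.1, hs.2], by linarith [hs.1, hs.2]⟩⟩
  exact h.hardyOn.comp (hmono hσ).1 (hmono hσ).2 (hmono hτ).1 (hmono hτ).2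

theorem tendsto_of_tendsto_quadrantMap {E : Type*} {f : ℝ × ℝ → E} {l : Filter E}
    (hσ : σ = 1 ∨ σ = -1) (hτ : τ = 1 ∨ τ = -1) {F G : Filter ℝ}
    (hF : Tendsto (fun s => σ * (s - x)) F (𝓝[>] 0))
    (hG : Tendsto (fun t => τ * (t - y)) G (𝓝[>] 0))
    (h : Tendsto (fun p => f (quadrantMap x y σ τ p)) (𝓝[>] 0 ×ˢ 𝓝[>] 0) l) :
    Tendsto f (F ×ˢ G) l := by
  refine (h.comp (hF.prodMap hG)).congr fun p => ?_
  have h1 : σ * σ = 1 := by rcases hσ with rfl | rfl <;> norm_num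
  have h2 : τ * τ = 1 := by rcases hτ with rfl | rfl <;> norm_num
  simp only [Function.comp_apply, quadrantMap, Prod.map, ← mul_assoc, h1, h2, one_mul,
    add_sub_cancel]

theorem tendsto_one_mul_sub_nhdsGT (x : ℝ) :
    Tendsto (fun s => 1 * (s - x)) (𝓝[>] x) (𝓝[>] 0) := by
  refine tendsto_nhdsWithin_iff.2 ⟨?_, ?_⟩
  · have := (by fun_prop : Continuous fun s => 1 * (s - x)).tendsto x
    simpa using this.mono_left nhdsWithin_le_nhds
  · filter_upwards [self_mem_nhdsWithin] with s hs
    simpa using hs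

theorem tendsto_neg_one_mul_sub_nhdsLT (x : ℝ) :
    Tendsto (fun s => -1 * (s - x)) (𝓝[<] x) (𝓝[>] 0) := by
  refine tendsto_nhdsWithin_iff.2 ⟨?_, ?_⟩
  · have := (by fun_prop : Continuous fun s => -1 * (s - x)).tendsto x
    simpa using this.mono_left nhdsWithin_le_nhds
  · filter_upwards [self_mem_nhdsWithin] with s hs
    simpa using hs

end Quadrants

theorem HardyOn.tendsto_setIntegral {g : ℝ × ℝ → ℝ} {a b : ℝ}
    (h : HardyOn g (Ioc 0 a) (Ioc 0 b)) (hg : Integrable g) (ha : 0 < a)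
    (hb : 0 < b) {L : ℝ} (hL : Tendsto g (𝓝[>] 0 ×ˢ 𝓝[>] 0) (𝓝 L)) :
    Tendsto (fun q : ℝ × ℝ => ∫ p in Ioc 0 a ×ˢ Ioc 0 b,
      g p * (dirichletKernel q.2 p.1 * dirichletKernel q.1 p.2))
      (atTop ×ˢ atTop) (𝓝 (L / 4)) := by
  refine (h.tendsto_integral_integral ha hb hL).congr fun q => ?_
  have hi := integrableOn_mul_dirichletKernel (S := Ioc 0 a ×ˢ Ioc 0 b) hg.integrableOn q.2 q.1
  rw [Measure.volume_eq_prod] at hi ⊢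
  rw [setIntegral_prod _ hi, intervalIntegral.integral_of_le ha.le]
  refine setIntegral_congr_fun measurableSet_Ioc fun s _ => ?_
  rw [intervalIntegral.integral_of_le hb.le, ← integral_mul_const]
  congr 1
  ext t
  ring

theorem setIntegral_Ioi_prod_Ioi_split {G : ℝ × ℝ → ℝ} (hG : Integrable G) {a b : ℝ} (ha : 0 < a)
    (hb : 0 < b) : ∫ p in Ioi 0 ×ˢ Ioi 0, G p =
      (∫ p in Ioc 0 a ×ˢ Ioc 0 b, G p) + (∫ p in Ioc 0 a ×ˢ Ioi b, G p) +
      (∫ p in Ioi a ×ˢ Ioc 0 b, G p) + ∫ p in Ioi a ×ˢ Ioi b, G p := by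
  have hd : ∀ {c : ℝ}, Disjoint (Ioc 0 c) (Ioi c) := fun {c} =>
    disjoint_left.2 fun p h1 h2 => not_lt.2 h1.2 h2
  have h2 : ∀ A : Set ℝ, MeasurableSet A → ∫ p in A ×ˢ Ioi 0, G p =
      (∫ p in A ×ˢ Ioc 0 b, G p) + ∫ p in A ×ˢ Ioi b, G p := fun A hA => by
    rw [← setIntegral_union _ (hA.prod measurableSet_Ioi) hG.integrableOn hG.integrableOn,
      ← prod_union, Ioc_union_Ioi_eq_Ioi hb.le]
    exact hd.set_prod_right _ _
  rw [← Ioc_union_Ioi_eq_Ioi ha.le, union_prod, Ioc_union_Ioi_eq_Ioi ha.le,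
    setIntegral_union (hd.set_prod_left _ _) (measurableSet_Ioi.prod measurableSet_Ioi)
      hG.integrableOn hG.integrableOn, h2 _ measurableSet_Ioc, h2 _ measurableSet_Ioi]
  ring

/-- The sum of the four reflections of a real function about `(x, y)`. -/
def realSymm (f : ℝ × ℝ → ℝ) (x y s t : ℝ) : ℝ :=
  f (x - s, y - t) + f (x + s, y + t) + f (x - s, y + t) + f (x + s, y - t)

/-- Pointwise convergence of the truncated inversion integrals of a real function. -/
theorem exists_tendsto_integral_dirichletKernel {f : ℝ × ℝ → ℝ} {x y ε₁ ε₂ : ℝ}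
    (hε₁ : 0 < ε₁) (hε₂ : 0 < ε₂) (hf : Integrable f)
    (hbv : IsBVF f (x - ε₁) (x + ε₁) (y - ε₂) (y + ε₂))
    (h₁ : ∃ a : ℝ, Integrable (fun t => realSymm f x y a t) ∧
      IntegrableOn (fun p : ℝ × ℝ => p.1⁻¹ * (realSymm f x y p.1 p.2 - realSymm f x y a p.2))
        (Ioc 0 ε₁ ×ˢ Ioi ε₂))
    (h₂ : ∃ b : ℝ, Integrable (fun s => realSymm f x y s b) ∧
      IntegrableOn (fun p : ℝ × ℝ => p.2⁻¹ * (realSymm f x y p.1 p.2 - realSymm f x y p.1 b))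
        (Ioi ε₁ ×ˢ Ioc 0 ε₂)) :
    ∃ lpp lpm lmp lmm : ℝ, Tendsto f (𝓝[>] x ×ˢ 𝓝[>] y) (𝓝 lpp) ∧
      Tendsto f (𝓝[>] x ×ˢ 𝓝[<] y) (𝓝 lpm) ∧ Tendsto f (𝓝[<] x ×ˢ 𝓝[>] y) (𝓝 lmp) ∧
      Tendsto f (𝓝[<] x ×ˢ 𝓝[<] y) (𝓝 lmm) ∧
      Tendsto (fun q : ℝ × ℝ => ∫ p, f p *
        (dirichletKernel q.2 (x - p.1) * dirichletKernel q.1 (y - p.2)))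
        (atTop ×ˢ atTop) (𝓝 ((1 / 4) * (lpp + lpm + lmp + lmm))) := by
  have p1 : (1 : ℝ) = 1 ∨ (1 : ℝ) = -1 := .inl rfl
  have m1 : (-1 : ℝ) = 1 ∨ (-1 : ℝ) = -1 := .inr rfl
  have key : ∀ {σ τ : ℝ}, (σ = 1 ∨ σ = -1) → (τ = 1 ∨ τ = -1) →
      ∃ L, Tendsto (fun p => f (quadrantMap x y σ τ p)) (𝓝[>] 0 ×ˢ 𝓝[>] 0) (𝓝 L) ∧
      Tendsto (fun q : ℝ × ℝ => ∫ p in Ioc 0 ε₁ ×ˢ Ioc 0 ε₂, f (quadrantMap x y σ τ p) *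
        (dirichletKernel q.2 p.1 * dirichletKernel q.1 p.2)) (atTop ×ˢ atTop) (𝓝 (L / 4)) := by
    intro σ τ hσ hτ
    have hH := hbv.hardyOn_quadrantMap hσ hτ
    obtain ⟨L, hL⟩ := hH.exists_tendsto hε₁ hε₂
    exact ⟨L, hL, hH.tendsto_setIntegral (integrable_comp_quadrantMap hf hσ hτ) hε₁ hε₂ hL⟩
  obtain ⟨lmm, hmm, cmm⟩ := key m1 m1
  obtain ⟨lpp, hpp, cpp⟩ := key p1 p1
  obtain ⟨lmp, hmp, cmp⟩ := key m1 p1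
  obtain ⟨lpm, hpm, cpm⟩ := key p1 m1
  refine ⟨lpp, lpm, lmp, lmm,
    tendsto_of_tendsto_quadrantMap p1 p1 (tendsto_one_mul_sub_nhdsGT x)
      (tendsto_one_mul_sub_nhdsGT y) hpp,
    tendsto_of_tendsto_quadrantMap p1 m1 (tendsto_one_mul_sub_nhdsGT x)
      (tendsto_neg_one_mul_sub_nhdsLT y) hpm,
    tendsto_of_tendsto_quadrantMap m1 p1 (tendsto_neg_one_mul_sub_nhdsLT x)
      (tendsto_one_mul_sub_nhdsGT y) hmp,
    tendsto_of_tendsto_quadrantMap m1 m1 (tendsto_neg_one_mul_sub_nhdsLT x)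
      (tendsto_neg_one_mul_sub_nhdsLT y) hmm, ?_⟩
  have imm := integrable_comp_quadrantMap (x := x) (y := y) hf m1 m1
  have ipp := integrable_comp_quadrantMap (x := x) (y := y) hf p1 p1
  have imp := integrable_comp_quadrantMap (x := x) (y := y) hf m1 p1
  have ipm := integrable_comp_quadrantMap (x := x) (y := y) hf p1 m1
  have hsym : ∀ p : ℝ × ℝ, realSymm f x y p.1 p.2 = f (quadrantMap x y (-1) (-1) p) +
      f (quadrantMap x y 1 1 p) + f (quadrantMap x y (-1) 1 p) + f (quadrantMap x y 1 (-1) p) := by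
    intro p
    simp only [realSymm, quadrantMap, one_mul, neg_one_mul, ← sub_eq_add_neg]
  have hG : Integrable (fun p : ℝ × ℝ => realSymm f x y p.1 p.2) := by
    simp_rw [hsym]
    exact ((imm.add ipp).add imp).add ipm
  obtain ⟨a, ha, ha'⟩ := h₁
  obtain ⟨b, hb, hb'⟩ := h₂
  have tA := tendsto_setIntegral_arm hε₁ hε₂ hG.integrableOn ha ha'
  have tB := tendsto_setIntegral_arm' hε₁ hε₂ hG.integrableOn hb hb'
  have tF := tendsto_setIntegral_far hε₁ hε₂ hG.integrableOn
  have tot := ((((((cmm.add cpp).add cmp).add cpm).add tA).add tB).add tF)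
  have elim : lmm / 4 + lpp / 4 + lmp / 4 + lpm / 4 + 0 + 0 + 0 =
      (1 / 4) * (lpp + lpm + lmp + lmm) := by ring
  rw [elim] at tot
  refine tot.congr fun q => ?_
  set k : ℝ × ℝ → ℝ := fun p => dirichletKernel q.2 p.1 * dirichletKernel q.1 p.2 with hk
  have hi : ∀ {E : ℝ × ℝ → ℝ} {S : Set (ℝ × ℝ)}, Integrable E →
      IntegrableOn (fun p => E p * k p) S := fun hE =>
    integrableOn_mul_dirichletKernel hE.integrableOn _ _
  have hi' : ∀ {E : ℝ × ℝ → ℝ}, Integrable E → Integrable (fun p => E p * k p) := fun hE => by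
    have := hi (S := univ) hE
    rwa [integrableOn_univ] at this
  have hfk : Integrable (fun p : ℝ × ℝ =>
      f p * (dirichletKernel q.2 (x - p.1) * dirichletKernel q.1 (y - p.2))) := by
    refine hf.mul_bdd (c := |q.2| / π * (|q.1| / π)) (by fun_prop)
      (Eventually.of_forall fun p => ?_)
    rw [norm_mul]
    exact mul_le_mul (abs_dirichletKernel_le _ _) (abs_dirichletKernel_le _ _) (norm_nonneg _)
      (by positivity)
  have hkq : ∀ {σ τ : ℝ}, (σ = 1 ∨ σ = -1) → (τ = 1 ∨ τ = -1) → ∀ p : ℝ × ℝ,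
      dirichletKernel q.2 (x - (quadrantMap x y σ τ p).1) *
        dirichletKernel q.1 (y - (quadrantMap x y σ τ p).2) = k p := by
    have h1 : ∀ {z σ M s : ℝ}, (σ = 1 ∨ σ = -1) →
        dirichletKernel M (z - (z + σ * s)) = dirichletKernel M s := by
      rintro z σ M s (rfl | rfl) <;> simp [dirichletKernel_neg]
    intro σ τ hσ hτ p
    simp only [quadrantMap, h1 hσ, h1 hτ, hk]
  rw [integral_eq_sum_quadrants hfk x y]
  simp only [hkq m1 m1, hkq p1 p1, hkq m1 p1, hkq p1 m1]
  have hsplit := setIntegral_Ioi_prod_Ioi_split (hi' hG) hε₁ hε₂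
  have hsum : ∀ S : Set (ℝ × ℝ), ∫ p in S, realSymm f x y p.1 p.2 * k p =
      (∫ p in S, f (quadrantMap x y (-1) (-1) p) * k p) +
      (∫ p in S, f (quadrantMap x y 1 1 p) * k p) +
      (∫ p in S, f (quadrantMap x y (-1) 1 p) * k p) +
      ∫ p in S, f (quadrantMap x y 1 (-1) p) * k p := fun S => by
    have j1 := hi (S := S) imm
    have j2 := hi (S := S) ipp
    have j3 := hi (S := S) imp
    have j4 := hi (S := S) ipm
    simp only [hsym, add_mul]
    rw [integral_add ?_ j4, integral_add ?_ j3, integral_add j1 j2]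
    exacts [j1.add j2, (j1.add j2).add j3]
  rw [← hsum (Ioi 0 ×ˢ Ioi 0), hsplit, hsum (Ioc 0 ε₁ ×ˢ Ioc 0 ε₂)]

/-! ### The truncated inversion integral as a Dirichlet integral -/

theorem norm_qi : ‖qi‖ = 1 := by
  have h : Quaternion.normSq qi = 1 := by
    rw [Quaternion.normSq_def']
    simp [qi]
  rw [Quaternion.normSq_eq_norm_mul_self] at h
  nlinarith [norm_nonneg qi]

theorem norm_qj : ‖qj‖ = 1 := by
  have h : Quaternion.normSq qj = 1 := by
    rw [Quaternion.normSq_def']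
    simp [qj]
  rw [Quaternion.normSq_eq_norm_mul_self] at h
  nlinarith [norm_nonneg qj]

section Exponentials

variable {e : ℍ[ℝ]}

/-- Euler's formula for an imaginary unit of the quaternions. -/
theorem exp_smul_eq (he : e.re = 0) (he1 : ‖e‖ = 1) (c : ℝ) :
    NormedSpace.exp (c • e) = ((cos c : ℝ) : ℍ[ℝ]) + sin c • e := by
  rw [Quaternion.exp_of_re_eq_zero _ (by simp [he]), norm_smul, he1, mul_one, Real.norm_eq_abs,
    cos_abs, smul_smul]
  congr 2
  rcases lt_trichotomy c 0 with h | rfl | h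
  · rw [abs_of_neg h, sin_neg, neg_div_neg_eq, div_mul_cancel₀ _ h.ne]
  · simp
  · rw [abs_of_pos h, div_mul_cancel₀ _ h.ne']

theorem norm_exp_smul (he : e.re = 0) (c : ℝ) : ‖NormedSpace.exp (c • e)‖ = 1 := by
  rw [Quaternion.norm_exp]
  simp [he]

theorem exp_smul_mul_exp_smul (a b : ℝ) (e : ℍ[ℝ]) :
    NormedSpace.exp (a • e) * NormedSpace.exp (b • e) = NormedSpace.exp ((a + b) • e) := by
  let : NormedAlgebra ℚ ℍ[ℝ] := NormedAlgebra.restrictScalars ℚ ℝ ℍ[ℝ]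
  rw [add_smul, NormedSpace.exp_add_of_commute]
  exact ((Commute.refl e).smul_left a).smul_right b

theorem continuous_exp_smul (he : e.re = 0) (he1 : ‖e‖ = 1) :
    Continuous fun c : ℝ => NormedSpace.exp (c • e) := by
  simp_rw [exp_smul_eq he he1]
  exact (Quaternion.continuous_coe.comp continuous_cos).add (continuous_sin.smul continuous_const)

/-- Over a symmetric interval of frequencies the exponentials integrate to a real number, a multiple
of the Dirichlet kernel: the imaginary part is odd in the frequency. -/
theorem integral_exp_smul (he : e.re = 0) (he1 : ‖e‖ = 1) (M r : ℝ) :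
    ∫ u in (-M)..M, NormedSpace.exp ((u * r) • e) =
      ((2 * π * dirichletKernel M r : ℝ) : ℍ[ℝ]) := by
  simp_rw [exp_smul_eq he he1]
  have hc : ∫ u in (-M)..M, cos (u * r) = 2 * π * dirichletKernel M r := by
    rw [dirichletKernel]
    rcases eq_or_ne r 0 with rfl | hr
    · simp
      field_simp
      ring
    rcases eq_or_ne M 0 with rfl | hM
    · simp
    rw [intervalIntegral.integral_comp_mul_right _ hr, integral_cos,
      sinc_of_ne_zero (mul_ne_zero hM hr), neg_mul, sin_neg, smul_eq_mul]
    field_simp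
    ring
  have hs : ∫ u in (-M)..M, sin (u * r) = 0 := by
    have h := intervalIntegral.integral_comp_neg (a := -M) (b := M) fun u => sin (u * r)
    simp only [neg_mul, sin_neg, intervalIntegral.integral_neg, neg_neg] at h
    linarith
  have i1 : Continuous fun u : ℝ => ((cos (u * r) : ℝ) : ℍ[ℝ]) :=
    Quaternion.continuous_coe.comp (by fun_prop)
  have i2 : Continuous fun u : ℝ => sin (u * r) • e := by fun_prop
  rw [intervalIntegral.integral_add (i1.intervalIntegrable _ _) (i2.intervalIntegrable _ _),
    intervalIntegral.integral_smul_const, hs, zero_smul, add_zero, ← hc]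
  have : (fun u : ℝ => ((cos (u * r) : ℝ) : ℍ[ℝ])) = fun u => cos (u * r) • (1 : ℍ[ℝ]) := by
    ext u <;> simp
  rw [this, intervalIntegral.integral_smul_const]
  ext <;> simp

end Exponentials

/-- By Fubini's theorem the truncated inversion integral is the integral of the function against a
product of Dirichlet kernels. These are real, so that they can be moved past the values of `f`. -/
theorem partialInverse_eq {f : ℝ × ℝ → ℍ[ℝ]} (hf : Integrable f) (x y : ℝ) {N M : ℝ}
    (hN : 0 ≤ N) (hM : 0 ≤ M) :
    partialInverse f x y N M =
      ∫ p, (dirichletKernel M (x - p.1) * dirichletKernel N (y - p.2)) • f p := by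
  have hi0 : qi.re = 0 := rfl
  have hj0 : qj.re = 0 := rfl
  set ν := volume.restrict (Ioc (-N) N)
  set μ := volume.restrict (Ioc (-M) M)
  let G : (ℝ × ℝ) → (ℝ × ℝ) → ℍ[ℝ] := fun w p =>
    NormedSpace.exp ((w.2 * (x - p.1)) • qi) * f p * NormedSpace.exp ((w.1 * (y - p.2)) • qj)
  have ci := continuous_exp_smul hi0 norm_qi
  have cj := continuous_exp_smul hj0 norm_qj
  have hGn : ∀ w p, ‖G w p‖ = ‖f p‖ := fun w p => by
    simp only [G, norm_mul, norm_exp_smul hi0, norm_exp_smul hj0, one_mul, mul_one]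
  have hGint : Integrable (Function.uncurry G) ((ν.prod μ).prod volume) := by
    have hfs : Integrable (fun z : (ℝ × ℝ) × (ℝ × ℝ) => f z.2) ((ν.prod μ).prod volume) :=
      hf.comp_snd (ν.prod μ)
    refine hfs.mono ?_ (Eventually.of_forall fun z => (hGn z.1 z.2).le)
    refine AEStronglyMeasurable.mul (AEStronglyMeasurable.mul ?_ hfs.aestronglyMeasurable) ?_
    · exact (ci.comp (by fun_prop : Continuous fun z : (ℝ × ℝ) × (ℝ × ℝ) =>
        z.1.2 * (x - z.2.1))).aestronglyMeasurable
    · exact (cj.comp (by fun_prop : Continuous fun z : (ℝ × ℝ) × (ℝ × ℝ) =>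
        z.1.1 * (y - z.2.2))).aestronglyMeasurable
  have h1 : ∀ u v : ℝ, NormedSpace.exp ((u * x) • qi) * twoSided f u v *
      NormedSpace.exp ((v * y) • qj) = ∫ p, G (v, u) p := by
    intro u v
    have hint : Integrable fun p : ℝ × ℝ =>
        NormedSpace.exp (-(u * p.1) • qi) * f p * NormedSpace.exp (-(v * p.2) • qj) := by
      refine hf.mono ?_ (Eventually.of_forall fun p => ?_)
      · refine AEStronglyMeasurable.mul (AEStronglyMeasurable.mul ?_ hf.aestronglyMeasurable) ?_
        · exact (ci.comp (by fun_prop : Continuous fun p : ℝ × ℝ =>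
            -(u * p.1))).aestronglyMeasurable
        · exact (cj.comp (by fun_prop : Continuous fun p : ℝ × ℝ =>
            -(v * p.2))).aestronglyMeasurable
      · simp only [norm_mul, norm_exp_smul hi0, norm_exp_smul hj0, one_mul, mul_one, le_refl]
    have := (ContinuousLinearMap.mulLeftRight ℝ ℍ[ℝ] (NormedSpace.exp ((u * x) • qi))
      (NormedSpace.exp ((v * y) • qj))).integral_comp_comm hint
    simp only [ContinuousLinearMap.mulLeftRight_apply] at this
    rw [twoSided, ← this]
    congr 1
    ext1 p
    simp only [G]
    rw [show u * (x - p.1) = u * x + -(u * p.1) by ring,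
      show v * (y - p.2) = -(v * p.2) + v * y by ring, ← exp_smul_mul_exp_smul,
      ← exp_smul_mul_exp_smul]
    simp only [mul_assoc]
  have h2 : ∀ p, ∫ w, G w p ∂(ν.prod μ) =
      ((2 * π * dirichletKernel M (x - p.1)) * (2 * π * dirichletKernel N (y - p.2))) • f p := by
    intro p
    have hGp : Integrable (fun w => G w p) (ν.prod μ) := by
      refine Integrable.of_bound ?_ ‖f p‖ (Eventually.of_forall fun w => (hGn w p).le)
      refine Continuous.aestronglyMeasurable ?_
      exact ((ci.comp (by fun_prop : Continuous fun w : ℝ × ℝ => w.2 * (x - p.1))).mul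
        continuous_const).mul
        (cj.comp (by fun_prop : Continuous fun w : ℝ × ℝ => w.1 * (y - p.2)))
    have hu := integral_exp_smul hi0 norm_qi M (x - p.1)
    have hv := integral_exp_smul hj0 norm_qj N (y - p.2)
    rw [intervalIntegral.integral_of_le (by linarith)] at hu hv
    have iu : Integrable (fun u : ℝ => NormedSpace.exp ((u * (x - p.1)) • qi)) μ := by
      refine Continuous.integrableOn_Ioc ?_
      exact ci.comp (by fun_prop : Continuous fun u : ℝ => u * (x - p.1))
    have iv : Integrable (fun v : ℝ => NormedSpace.exp ((v * (y - p.2)) • qj)) ν := by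
      refine Continuous.integrableOn_Ioc ?_
      exact cj.comp (by fun_prop : Continuous fun v : ℝ => v * (y - p.2))
    rw [integral_prod _ hGp]
    have e1 : ∀ v : ℝ, ∫ u, G (v, u) p ∂μ = ((2 * π * dirichletKernel M (x - p.1) : ℝ) : ℍ[ℝ]) *
        f p * NormedSpace.exp ((v * (y - p.2)) • qj) := fun v => by
      rw [← hu]
      have := (ContinuousLinearMap.mulLeftRight ℝ ℍ[ℝ] 1
        (f p * NormedSpace.exp ((v * (y - p.2)) • qj))).integral_comp_comm iu
      simpa only [ContinuousLinearMap.mulLeftRight_apply, one_mul, G, mul_assoc] using this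
    simp_rw [e1]
    have := (ContinuousLinearMap.mulLeftRight ℝ ℍ[ℝ]
      (((2 * π * dirichletKernel M (x - p.1) : ℝ) : ℍ[ℝ]) * f p) 1).integral_comp_comm iv
    simp only [ContinuousLinearMap.mulLeftRight_apply, mul_one] at this
    rw [this, hv, ← Quaternion.coe_commutes, ← mul_assoc, ← Quaternion.coe_mul,
      Quaternion.coe_mul_eq_smul, mul_comm]
  have h3 : ∫ v in (-N)..N, ∫ u in (-M)..M, NormedSpace.exp ((u * x) • qi) * twoSided f u v *
      NormedSpace.exp ((v * y) • qj) = ∫ p, ∫ w, G w p ∂(ν.prod μ) := by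
    rw [← integral_integral_swap hGint,
      integral_prod (fun w => ∫ p, G w p) hGint.integral_prod_left,
      intervalIntegral.integral_of_le (by linarith)]
    refine integral_congr_ae (Eventually.of_forall fun v => ?_)
    simp only [intervalIntegral.integral_of_le (by linarith : -M ≤ M), h1]
    rfl
  rw [partialInverse, h3]
  simp_rw [h2]
  rw [← integral_smul]
  congr 1
  ext1 p
  rw [smul_smul]
  congr 1
  field_simp
  ring

/-! ### Components of quaternion-valued functions -/

section Components

/-- The real part of a quaternion, as a continuous linear map. -/
def reL : ℍ[ℝ] →L[ℝ] ℝ where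
  toFun q := q.re
  map_add' _ _ := rfl
  map_smul' _ _ := rfl
  cont := Quaternion.continuous_re

/-- The `i`-component of a quaternion, as a continuous linear map. -/
def imIL : ℍ[ℝ] →L[ℝ] ℝ where
  toFun q := q.imI
  map_add' _ _ := rfl
  map_smul' _ _ := rfl
  cont := Quaternion.continuous_imI

/-- The `j`-component of a quaternion, as a continuous linear map. -/
def imJL : ℍ[ℝ] →L[ℝ] ℝ where
  toFun q := q.imJ
  map_add' _ _ := rfl
  map_smul' _ _ := rfl
  cont := Quaternion.continuous_imJ

/-- The `k`-component of a quaternion, as a continuous linear map. -/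
def imKL : ℍ[ℝ] →L[ℝ] ℝ where
  toFun q := q.imK
  map_add' _ _ := rfl
  map_smul' _ _ := rfl
  cont := Quaternion.continuous_imK

theorem tendsto_quaternion {α : Type*} {F : Filter α} {f : α → ℍ[ℝ]} {q : ℍ[ℝ]}
    (h0 : Tendsto (fun i => reL (f i)) F (𝓝 (reL q)))
    (h1 : Tendsto (fun i => imIL (f i)) F (𝓝 (imIL q)))
    (h2 : Tendsto (fun i => imJL (f i)) F (𝓝 (imJL q)))
    (h3 : Tendsto (fun i => imKL (f i)) F (𝓝 (imKL q))) : Tendsto f F (𝓝 q) := by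
  have e : ∀ r : ℍ[ℝ], reL r • (1 : ℍ[ℝ]) + imIL r • qi + imJL r • qj + imKL r • (qi * qj) = r := by
    intro r
    obtain ⟨i0, i1, i2, i3⟩ : qi.re = 0 ∧ qi.imI = 1 ∧ qi.imJ = 0 ∧ qi.imK = 0 :=
      ⟨rfl, rfl, rfl, rfl⟩
    obtain ⟨j0, j1, j2, j3⟩ : qj.re = 0 ∧ qj.imI = 0 ∧ qj.imJ = 1 ∧ qj.imK = 0 :=
      ⟨rfl, rfl, rfl, rfl⟩
    change r.re • (1 : ℍ[ℝ]) + r.imI • qi + r.imJ • qj + r.imK • (qi * qj) = r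
    ext <;> simp [i0, i1, i2, i3, j0, j1, j2, j3]
  have := (((h0.smul_const (1 : ℍ[ℝ])).add (h1.smul_const qi)).add (h2.smul_const qj)).add
    (h3.smul_const (qi * qj))
  simpa only [e] using this

theorem IsLC.fst_comp {f : ℝ × ℝ → ℍ[ℝ]} {x y ε₁ ε₂ : ℝ} (h : IsLC f x y ε₁ ε₂)
    (T : ℍ[ℝ] →L[ℝ] ℝ) :
    ∃ a : ℝ, Integrable (fun t => realSymm (fun p => T (f p)) x y a t) ∧
      IntegrableOn (fun p : ℝ × ℝ => p.1⁻¹ * (realSymm (fun p => T (f p)) x y p.1 p.2 -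
        realSymm (fun p => T (f p)) x y a p.2)) (Ioc 0 ε₁ ×ˢ Ioi ε₂) := by
  obtain ⟨a, h1, h2⟩ := h.fst
  refine ⟨a, (T.integrable_comp h1).congr (Eventually.of_forall fun t => ?_),
    (T.integrable_comp h2).congr (Eventually.of_forall fun p => ?_)⟩ <;>
  simp only [symm, realSymm, map_add, map_sub, map_smul, smul_eq_mul]

theorem IsLC.snd_comp {f : ℝ × ℝ → ℍ[ℝ]} {x y ε₁ ε₂ : ℝ} (h : IsLC f x y ε₁ ε₂)
    (T : ℍ[ℝ] →L[ℝ] ℝ) :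
    ∃ b : ℝ, Integrable (fun s => realSymm (fun p => T (f p)) x y s b) ∧
      IntegrableOn (fun p : ℝ × ℝ => p.2⁻¹ * (realSymm (fun p => T (f p)) x y p.1 p.2 -
        realSymm (fun p => T (f p)) x y p.1 b)) (Ioi ε₁ ×ˢ Ioc 0 ε₂) := by
  obtain ⟨b, h1, h2⟩ := h.snd
  refine ⟨b, (T.integrable_comp h1).congr (Eventually.of_forall fun t => ?_),
    (T.integrable_comp h2).congr (Eventually.of_forall fun p => ?_)⟩ <;>
  simp only [symm, realSymm, map_add, map_sub, map_smul, smul_eq_mul]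

/-- Pointwise inversion for one component of a quaternion-valued function. -/
theorem exists_tendsto_partialInverse_comp {f : ℝ × ℝ → ℍ[ℝ]} {x y ε₁ ε₂ : ℝ}
    (hε₁ : 0 < ε₁) (hε₂ : 0 < ε₂) (hf : Integrable f) (hlc : IsLC f x y ε₁ ε₂)
    (T : ℍ[ℝ] →L[ℝ] ℝ)
    (hbv : IsBVF (fun p => T (f p)) (x - ε₁) (x + ε₁) (y - ε₂) (y + ε₂)) :
    ∃ lpp lpm lmp lmm : ℝ, Tendsto (fun p => T (f p)) (𝓝[>] x ×ˢ 𝓝[>] y) (𝓝 lpp) ∧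
      Tendsto (fun p => T (f p)) (𝓝[>] x ×ˢ 𝓝[<] y) (𝓝 lpm) ∧
      Tendsto (fun p => T (f p)) (𝓝[<] x ×ˢ 𝓝[>] y) (𝓝 lmp) ∧
      Tendsto (fun p => T (f p)) (𝓝[<] x ×ˢ 𝓝[<] y) (𝓝 lmm) ∧
      Tendsto (fun q : ℝ × ℝ => T (partialInverse f x y q.1 q.2))
        (atTop ×ˢ atTop) (𝓝 ((1 / 4) * (lpp + lpm + lmp + lmm))) := by
  obtain ⟨lpp, lpm, lmp, lmm, h1, h2, h3, h4, h5⟩ := exists_tendsto_integral_dirichletKernel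
    hε₁ hε₂ (T.integrable_comp hf) hbv (hlc.fst_comp T) (hlc.snd_comp T)
  refine ⟨lpp, lpm, lmp, lmm, h1, h2, h3, h4, h5.congr' ?_⟩
  have e : ∀ᶠ q : ℝ × ℝ in atTop ×ˢ atTop, 0 ≤ q.1 ∧ 0 ≤ q.2 :=
    (eventually_ge_atTop 0).prod_mk (eventually_ge_atTop 0)
  filter_upwards [e] with q hq
  have hi : Integrable fun p : ℝ × ℝ =>
      (dirichletKernel q.2 (x - p.1) * dirichletKernel q.1 (y - p.2)) • f p := by
    refine hf.bdd_smul (|q.2| / π * (|q.1| / π)) (by fun_prop : Continuous fun p : ℝ × ℝ =>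
      dirichletKernel q.2 (x - p.1) * dirichletKernel q.1 (y - p.2)).aestronglyMeasurable
      (Eventually.of_forall fun p => ?_)
    rw [norm_mul]
    exact mul_le_mul (abs_dirichletKernel_le _ _) (abs_dirichletKernel_le _ _) (norm_nonneg _)
      (by positivity)
  rw [partialInverse_eq hf x y hq.1 hq.2, ← T.integral_comp_comm hi]
  simp only [map_smul, smul_eq_mul, mul_comm]

end Components

theorem cornerAverage_eq {E : Type*} [TopologicalSpace E] [T2Space E] [AddCommGroup E]
    [Module ℝ E] {g : ℝ × ℝ → E} {x y : ℝ} {lpp lpm lmp lmm : E}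
    (hpp : Tendsto g (𝓝[>] x ×ˢ 𝓝[>] y) (𝓝 lpp)) (hpm : Tendsto g (𝓝[>] x ×ˢ 𝓝[<] y) (𝓝 lpm))
    (hmp : Tendsto g (𝓝[<] x ×ˢ 𝓝[>] y) (𝓝 lmp)) (hmm : Tendsto g (𝓝[<] x ×ˢ 𝓝[<] y) (𝓝 lmm)) :
    cornerAverage g x y = (1 / 4 : ℝ) • (lpp + lpm + lmp + lmm) := by
  rw [cornerAverage, hpp.limUnder_eq, hpm.limUnder_eq, hmp.limUnder_eq, hmm.limUnder_eq]

theorem cornerAverage_eq_of_continuousAt {E : Type*} [TopologicalSpace E] [T2Space E]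
    [AddCommGroup E] [Module ℝ E] {g : ℝ × ℝ → E} {x y : ℝ} (hg : ContinuousAt g (x, y)) :
    cornerAverage g x y = g (x, y) := by
  have h : ∀ {s t : Set ℝ}, Tendsto g (𝓝[s] x ×ˢ 𝓝[t] y) (𝓝 (g (x, y))) := fun {s t} => by
    refine hg.mono_left ?_
    rw [nhds_prod_eq]
    exact prod_mono nhdsWithin_le_nhds nhdsWithin_le_nhds
  rw [cornerAverage_eq h h h h]
  module

end QFT

theorem mainTheorem2 (f : ℝ × ℝ → Quaternion ℝ) (x₀ y₀ ε₁ ε₂ : ℝ)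
    (hε₁ : 0 < ε₁) (hε₂ : 0 < ε₂)
    (hf : MeasureTheory.Integrable f)
    (hbv : QFT.IsQBVF f (x₀ - ε₁) (x₀ + ε₁) (y₀ - ε₂) (y₀ + ε₂))
    (hlc : QFT.IsLC f x₀ y₀ ε₁ ε₂) :
    QFT.HasCornerLimits f x₀ y₀ ∧
    QFT.cornerAverage f x₀ y₀ =
      ⟨QFT.cornerAverage (fun p => (f p).re) x₀ y₀,
        QFT.cornerAverage (fun p => (f p).imI) x₀ y₀,
        QFT.cornerAverage (fun p => (f p).imJ) x₀ y₀,
        QFT.cornerAverage (fun p => (f p).imK) x₀ y₀⟩ ∧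
    Filter.Tendsto (fun NM : ℝ × ℝ => QFT.partialInverse f x₀ y₀ NM.1 NM.2)
      (Filter.atTop ×ˢ Filter.atTop) (nhds (QFT.cornerAverage f x₀ y₀)) ∧
    (ContinuousAt f (x₀, y₀) → QFT.cornerAverage f x₀ y₀ = f (x₀, y₀)) := by
  obtain ⟨app, apm, amp, amm, a1, a2, a3, a4, a5⟩ :=
    QFT.exists_tendsto_partialInverse_comp hε₁ hε₂ hf hlc QFT.reL hbv.re
  obtain ⟨bpp, bpm, bmp, bmm, b1, b2, b3, b4, b5⟩ :=
    QFT.exists_tendsto_partialInverse_comp hε₁ hε₂ hf hlc QFT.imIL hbv.imI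
  obtain ⟨cpp, cpm, cmp, cmm, c1, c2, c3, c4, c5⟩ :=
    QFT.exists_tendsto_partialInverse_comp hε₁ hε₂ hf hlc QFT.imJL hbv.imJ
  obtain ⟨dpp, dpm, dmp, dmm, d1, d2, d3, d4, d5⟩ :=
    QFT.exists_tendsto_partialInverse_comp hε₁ hε₂ hf hlc QFT.imKL hbv.imK
  have hpp := QFT.tendsto_quaternion (q := ⟨app, bpp, cpp, dpp⟩) a1 b1 c1 d1
  have hpm := QFT.tendsto_quaternion (q := ⟨apm, bpm, cpm, dpm⟩) a2 b2 c2 d2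
  have hmp := QFT.tendsto_quaternion (q := ⟨amp, bmp, cmp, dmp⟩) a3 b3 c3 d3
  have hmm := QFT.tendsto_quaternion (q := ⟨amm, bmm, cmm, dmm⟩) a4 b4 c4 d4
  have hav := QFT.cornerAverage_eq hpp hpm hmp hmm
  have ha : QFT.cornerAverage (fun p => (f p).re) x₀ y₀ = _ := QFT.cornerAverage_eq a1 a2 a3 a4
  have hb : QFT.cornerAverage (fun p => (f p).imI) x₀ y₀ = _ := QFT.cornerAverage_eq b1 b2 b3 b4
  have hc : QFT.cornerAverage (fun p => (f p).imJ) x₀ y₀ = _ := QFT.cornerAverage_eq c1 c2 c3 c4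
  have hd : QFT.cornerAverage (fun p => (f p).imK) x₀ y₀ = _ := QFT.cornerAverage_eq d1 d2 d3 d4
  refine ⟨⟨⟨_, hpp⟩, ⟨_, hpm⟩, ⟨_, hmp⟩, ⟨_, hmm⟩⟩, ?_, ?_, QFT.cornerAverage_eq_of_continuousAt⟩
  · rw [hav, ha, hb, hc, hd]
    rfl
  · rw [hav]
    exact QFT.tendsto_quaternion a5 b5 c5 d5
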